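/- Graphs are finite, and a plane embedding of a graph is given combinatorially: by a circular ordering of the edges at each vertex that is realisable by a planar drawing (of each connected component). A \emph{flip} keeps the graph and changes its plane embedding: it takes a subgraph that is separated from the rest of the graph by a single vertex (articulation flip) or by a pair of vertices (separation flip), and whose edges are consecutive in the circular orderings at these vertices, and either reflects it in place or slides it, unreflected, to a new position in the circular orderings at the separating vertices, the result being again a plane embedding. A dynamic graph is maintained together with a plane embedding: an edge is inserted across a face of the current embedding or deleted from it, and any number of flips may be performed before and after each such update. There are constants $c>0$ and $N$ such that for every $n\ge 2$ there are a planar graph $G$ on $n$ vertices and an adaptive adversary with the following property. Starting from $G$, with any plane embedding, the adversary issues an arbitrarily long sequence of alternating edge insertions and edge deletions, beginning with an insertion; each edge is chosen depending on the plane embeddings held so far, and, however these embeddings are chosen, each inserted edge is new and keeps the graph planar, and each deleted edge is present. If $n\ge N$, then, whatever flips are performed, each insertion requires at least $c\log n$ flips. Consequently, the bound also holds in the amortized sense: for every $m$, the total number of flips during the first $m$ updates is at least $c\,m\log n$. -/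

import Mathlib

/-- `l` lists the neighbours of `v` in `G`, each exactly once. Read cyclically, such a list is a
circular ordering of the edges at `v`, and `l.formPerm` is its successor permutation. -/
def IsNeighborList {V : Type*} (G : SimpleGraph V) (v : V) (l : List V) : Prop :=
  l.Nodup ∧ ∀ w, w ∈ l ↔ G.Adj v w

/-- The face-tracing relation on darts: after the dart `u → v` comes the dart `v → w`, where
`v w` is the edge that follows `v u` in the circular ordering at `v`. The classes of the
equivalence relation it generates are the face boundaries. -/
def FaceStep {V : Type*} (G : SimpleGraph V) (rot : V → Equiv.Perm V) (d d' : G.Dart) : Prop :=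
  d'.fst = d.snd ∧ d'.snd = rot d.snd d.fst

/-- The number of faces, every connected component being drawn on a sphere of its own (so that
an isolated vertex, which has no darts, contributes one face). -/
noncomputable def numFaces {V : Type*} (G : SimpleGraph V) (rot : V → Equiv.Perm V) : ℕ :=
  Nat.card (Quot (FaceStep G rot)) + {v : V | ∀ w, ¬ G.Adj v w}.ncard

/-- A plane embedded graph on the finite vertex set `V`, combinatorially: a graph with a circular
ordering of the edges at every vertex (`rot v` maps a neighbour of `v` to the next one) which is
realisable in the plane, i.e. has genus `0` on every connected component. As `V - E + F ≤ 2`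
holds on each component, this is Euler's formula `V - E + F = 2 C`, with `C` the number of
components. -/
structure PlaneGraph (V : Type*) [DecidableEq V] where
  graph : SimpleGraph V
  rot : V → Equiv.Perm V
  circular : ∀ v, ∃ l, IsNeighborList graph v l ∧ rot v = l.formPerm
  euler : Nat.card V + numFaces graph rot =
    graph.edgeSet.ncard + 2 * Nat.card graph.ConnectedComponent

/-- A graph is planar if it has a plane embedding. -/
def IsPlanarGraph {V : Type*} [DecidableEq V] (G : SimpleGraph V) : Prop :=
  ∃ H : PlaneGraph V, H.graph = G

/-- The subgraph formed by the edges in `A` meets the rest of the graph only in vertices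
of `S`. -/
def IsSeparatedBy {V : Type*} (G : SimpleGraph V) (S : Finset V) (A : Set (Sym2 V)) : Prop :=
  ∀ v a b, G.Adj v a → G.Adj v b → s(v, a) ∈ A → s(v, b) ∉ A → v ∈ S

/-- `H'` arises from `H` by reflecting the subgraph `A` in place: at every vertex the edges of
`A` are consecutive, and this block is reversed. (A vertex not in the separating set has only
edges in `A`, and then its whole ordering is reversed, or no edge in `A`, and then nothing
changes.) -/
def IsReflect {V : Type*} [DecidableEq V] (A : Set (Sym2 V)) (H H' : PlaneGraph V) : Prop :=
  ∀ v, ∃ α β : List V, IsNeighborList H.graph v (α ++ β) ∧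
    (∀ w ∈ α, s(v, w) ∈ A) ∧ (∀ w ∈ β, s(v, w) ∉ A) ∧
    H.rot v = (α ++ β).formPerm ∧ H'.rot v = (α.reverse ++ β).formPerm

/-- `H'` arises from `H` by sliding the subgraph `A`: at every vertex the edges of `A` are
consecutive, and this block is moved, without being reversed, to some position in the circular
ordering. (At a vertex not in the separating set this changes nothing.) -/
def IsSlide {V : Type*} [DecidableEq V] (A : Set (Sym2 V)) (H H' : PlaneGraph V) : Prop :=
  ∀ v, ∃ α β γ : List V, IsNeighborList H.graph v (α ++ β ++ γ) ∧
    (∀ w ∈ α, s(v, w) ∈ A) ∧ (∀ w ∈ β ++ γ, s(v, w) ∉ A) ∧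
    H.rot v = (α ++ β ++ γ).formPerm ∧ H'.rot v = (β ++ α ++ γ).formPerm

/-- A single flip keeps the graph and changes the plane embedding, by reflecting or sliding a
subgraph that is separated from the rest of the graph by one vertex (articulation flip) or by
two vertices (separation flip). -/
def IsFlip {V : Type*} [DecidableEq V] (H H' : PlaneGraph V) : Prop :=
  H'.graph = H.graph ∧ ∃ (S : Finset V) (A : Set (Sym2 V)),
    (S.card = 1 ∨ S.card = 2) ∧ IsSeparatedBy H.graph S A ∧ (IsReflect A H H' ∨ IsSlide A H H')

/-- `FlipSeq k H H'`: some sequence of exactly `k` flips transforms `H` into `H'`. -/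
inductive FlipSeq {V : Type*} [DecidableEq V] : ℕ → PlaneGraph V → PlaneGraph V → Prop
  | refl (H : PlaneGraph V) : FlipSeq 0 H H
  | step {k : ℕ} {H K L : PlaneGraph V} : FlipSeq k H K → IsFlip K L → FlipSeq (k + 1) H L

/-- At the vertex `x`, the circular ordering of `H'` is that of `H` with the new neighbour `y`
put in at some corner. -/
def AddsNeighbor {V : Type*} [DecidableEq V] (x y : V) (H H' : PlaneGraph V) : Prop :=
  ∃ l : List V, IsNeighborList H.graph x l ∧
    H.rot x = l.formPerm ∧ H'.rot x = (y :: l).formPerm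

/-- `H'` arises from `H` by inserting the new edge `x y` across a face (equivalently, `H` arises
from `H'` by deleting the edge `x y`); all other edges keep their circular orderings. -/
def IsEdgeInsertion {V : Type*} [DecidableEq V] (x y : V) (H H' : PlaneGraph V) : Prop :=
  x ≠ y ∧ ¬ H.graph.Adj x y ∧ H'.graph = H.graph ⊔ SimpleGraph.edge x y ∧
    AddsNeighbor x y H H' ∧ AddsNeighbor y x H H' ∧
    ∀ v, v ≠ x → v ≠ y → H'.rot v = H.rot v

/-- From the embedding `H` one can get to `H'` by inserting the edge `x y` across a face and
performing `k` flips in total, before and after the insertion. -/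
def InsertWithFlips {V : Type*} [DecidableEq V] (x y : V) (k : ℕ) (H H' : PlaneGraph V) : Prop :=
  ∃ (k₁ k₂ : ℕ) (K L : PlaneGraph V), k = k₁ + k₂ ∧
    FlipSeq k₁ H K ∧ IsEdgeInsertion x y K L ∧ FlipSeq k₂ L H'

/-- From the embedding `H` one can get to `H'` by deleting the edge `x y` and performing `k`
flips in total, before and after the deletion. -/
def DeleteWithFlips {V : Type*} [DecidableEq V] (x y : V) (k : ℕ) (H H' : PlaneGraph V) : Prop :=
  ∃ (k₁ k₂ : ℕ) (K L : PlaneGraph V), k = k₁ + k₂ ∧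
    FlipSeq k₁ H K ∧ IsEdgeInsertion x y L K ∧ FlipSeq k₂ L H'

/-- An adaptive adversary: from the history, i.e. the list of all plane embeddings held so far
(the last one is the current one), it chooses the two endpoints of the next edge to be inserted
or deleted. -/
abbrev Adversary (V : Type*) [DecidableEq V] : Type _ := List (PlaneGraph V) → V × V

/-- The edge chosen for update number `j` (counted from `0`), if `E i` is the embedding held
after `i` updates. -/
def nextEdge {V : Type*} [DecidableEq V] (adv : Adversary V) (E : ℕ → PlaneGraph V) (j : ℕ) :
    V × V :=
  adv ((List.range (j + 1)).map E)

/-- `E 0, …, E m` are plane embeddings, chosen in any way whatever, of the dynamic graph that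
starts as `G` and undergoes `m` alternating updates: the updates number `0, 2, 4, …` insert, and
the updates number `1, 3, 5, …` delete the edge that the adversary chooses. -/
def IsRun {V : Type*} [DecidableEq V] (G : SimpleGraph V) (adv : Adversary V) (m : ℕ)
    (E : ℕ → PlaneGraph V) : Prop :=
  (E 0).graph = G ∧ ∀ j < m,
    (Even j → (E (j + 1)).graph =
      (E j).graph ⊔ SimpleGraph.edge (nextEdge adv E j).1 (nextEdge adv E j).2) ∧
    (¬ Even j → (E (j + 1)).graph =
      (E j).graph.deleteEdges {s((nextEdge adv E j).1, (nextEdge adv E j).2)})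

/-- Update number `j` is legitimate: an edge to be inserted joins distinct non-adjacent vertices
and leaves the graph planar; an edge to be deleted is present. -/
def IsLegalUpdate {V : Type*} [DecidableEq V] (adv : Adversary V) (E : ℕ → PlaneGraph V)
    (j : ℕ) : Prop :=
  (Even j → (nextEdge adv E j).1 ≠ (nextEdge adv E j).2 ∧
    ¬ (E j).graph.Adj (nextEdge adv E j).1 (nextEdge adv E j).2 ∧
    IsPlanarGraph ((E j).graph ⊔
      SimpleGraph.edge (nextEdge adv E j).1 (nextEdge adv E j).2)) ∧
  (¬ Even j → (E j).graph.Adj (nextEdge adv E j).1 (nextEdge adv E j).2)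

/-- Update number `j`, which takes the embedding `E j` to `E (j + 1)`, can be performed with
`k` flips. -/
def UpdateWithFlips {V : Type*} [DecidableEq V] (adv : Adversary V) (E : ℕ → PlaneGraph V)
    (j k : ℕ) : Prop :=
  (Even j → InsertWithFlips (nextEdge adv E j).1 (nextEdge adv E j).2 k (E j) (E (j + 1))) ∧
  (¬ Even j → DeleteWithFlips (nextEdge adv E j).1 (nextEdge adv E j).2 k (E j) (E (j + 1)))

/-!
The graph is a complete binary tree of depth `d` (in heap numbering: root `1`, children `2 * x` and
`2 * x + 1`) whose root and leaves are joined to an apex `0`, together with isolated vertices. The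
adversary always inserts an edge from the root to a leaf, and then deletes it.

*What an insertion forces.* Once the edge from the root to a leaf `l` is drawn, it closes a cycle
with the tree path to `l`. Everything else in the component hangs together at the apex, hence lies
on one side of the cycle. So the path, seen from the root, turns to the same side at all its inner
vertices (`rot_heapPath_of_edge`, from `rot_iff_rot_of_cycle`). Conversely, every leaf can be
joined to the root without losing planarity (`isPlanarGraph_heapGraph_sup_edge`).

*What a flip can do.* At a vertex that is not one of the two separating vertices, a flip either
keeps or reverses the circular ordering, and it does the same at all vertices connected to it in
the rest of the graph. Along a path, therefore, a flip changes the relation between the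
orientations of successive vertices in at most four places (`alternations_le_of_isFlip`).

*What the adversary does.* Given an embedding, it descends from the root and chooses the child so
that the turns alternate. All `d - 2` alternations have to be removed before the leaf at the end
of the path can be joined to the root, which takes at least `(d - 2) / 4` flips
(`exists_leaf_of_planeGraph`).

The topology is handled by linear algebra over `𝔽₂`. The boundary map from sets of faces to sets of
edges has its range in the cycle space, which has dimension at most `E - V + C`, and its kernel has
dimension at most `C`. This gives `V + F ≤ E + 2 C` for every rotation system
(`euler_inequality`), so a rotation system is shown to be plane by exhibiting enough faces
(`isPlanarGraph_of_labels`). If equality holds, then the range is the whole cycle space, i.e. every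
cycle is the boundary of a set of faces (`exists_faceColoring`), which is the form of the Jordan
curve theorem that is needed.
-/

/-! ### Circular orderings -/

/-- Every neighbour is reached from every other one by the successor permutation: a function that
is invariant under it is constant on the neighbours. -/
theorem eq_of_invariant_rot {V α : Type*} [DecidableEq V] {G : SimpleGraph V} {v : V}
    {π : Equiv.Perm V} (hπ : ∃ l, IsNeighborList G v l ∧ π = l.formPerm) {φ : V → α}
    (h : ∀ w, G.Adj v w → φ (π w) = φ w) {a b : V} (ha : G.Adj v a) (hb : G.Adj v b) :
    φ a = φ b := by
  obtain ⟨l, ⟨hnd, hmem⟩, rfl⟩ := hπ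
  have key : ∀ i (hi : i < l.length), φ l[i] = φ (l[0]'(by omega)) := by
    intro i
    induction i with
    | zero => intro _; rfl
    | succ i ih =>
      intro hi
      have := h l[i] ((hmem _).1 (List.getElem_mem _))
      rw [List.formPerm_apply_lt_getElem l hnd i hi] at this
      rw [this, ih]
  obtain ⟨i, hi, rfl⟩ := List.getElem_of_mem ((hmem a).2 ha)
  obtain ⟨j, hj, rfl⟩ := List.getElem_of_mem ((hmem b).2 hb)
  rw [key i hi, key j hj]

theorem adj_rot {V : Type*} [DecidableEq V] {G : SimpleGraph V} {v : V}
    {π : Equiv.Perm V} (hπ : ∃ l, IsNeighborList G v l ∧ π = l.formPerm) (w : V) :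
    G.Adj v (π w) ↔ G.Adj v w := by
  obtain ⟨l, ⟨hnd, hmem⟩, rfl⟩ := hπ
  rw [← hmem, ← hmem, List.formPerm_mem_iff_mem]

/-! ### Mod 2 homology of rotation systems -/

section Homology

set_option linter.unusedSectionVars false

variable {V : Type*} [Fintype V] [DecidableEq V] (G : SimpleGraph V) (rot : V → Equiv.Perm V)

/-- The vertex-edge incidence matrix over `𝔽₂`. Its kernel is the cycle space of the graph. -/
noncomputable def edgeIncidence : Matrix V G.edgeSet (ZMod 2) :=
  open scoped Classical in fun v e => if v ∈ (e : Sym2 V) then 1 else 0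

/-- The faces of a rotation system: the classes of darts under face tracing, and one face for
every isolated vertex. -/
abbrev Face : Type _ := Quot (FaceStep G rot) ⊕ {v : V | ∀ w, ¬ G.Adj v w}

instance : Finite (Face G rot) := by
  classical
  have : Finite (Quot (FaceStep G rot)) := Quot.finite _
  infer_instance

theorem finrank_face : Module.finrank (ZMod 2) (Face G rot → ZMod 2) = numFaces G rot := by
  classical
  have : Finite (Quot (FaceStep G rot)) := Quot.finite _
  have : Fintype (Face G rot) := Fintype.ofFinite _
  rw [Module.finrank_fintype_fun_eq_card, ← Nat.card_eq_fintype_card, Nat.card_sum, numFaces,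
    Nat.card_coe_set_eq]

/-- The dart function that a function on the faces induces: the value on the face along which
the dart `a → b` runs (and `0` if `a` and `b` are not adjacent). -/
noncomputable def dartVal (f : Face G rot → ZMod 2) (a b : V) : ZMod 2 :=
  open scoped Classical in
  if h : G.Adj a b then f (Sum.inl (Quot.mk _ ⟨(a, b), h⟩)) else 0

variable {G rot} in
theorem dartVal_rot (hrot : ∀ v, ∃ l, IsNeighborList G v l ∧ rot v = l.formPerm)
    (f : Face G rot → ZMod 2) (a b : V) :
    dartVal G rot f b (rot b a) = dartVal G rot f a b := by
  unfold dartVal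
  by_cases h : G.Adj a b
  · have h' : G.Adj b (rot b a) := (adj_rot (hrot b) a).2 h.symm
    rw [dif_pos h, dif_pos h']
    congr 2
    exact (Quot.sound ⟨rfl, rfl⟩).symm
  · have h' : ¬ G.Adj b (rot b a) := fun h' => h ((adj_rot (hrot b) a).1 h').symm
    rw [dif_neg h, dif_neg h']

/-- The boundary of a set of faces: the edges with exactly one of their two sides in the set. -/
noncomputable def faceBoundary : (Face G rot → ZMod 2) →ₗ[ZMod 2] (G.edgeSet → ZMod 2) where
  toFun f e := Sym2.lift ⟨fun a b => dartVal G rot f a b + dartVal G rot f b a,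
    fun _ _ => add_comm _ _⟩ (e : Sym2 V)
  map_add' f g := by
    ext ⟨e, he⟩
    induction e with
    | _ a b =>
      have h : G.Adj a b := he
      simp only [Sym2.lift_mk, Pi.add_apply, dartVal, dif_pos h, dif_pos h.symm]
      ring
  map_smul' c f := by
    ext ⟨e, he⟩
    induction e with
    | _ a b =>
      have h : G.Adj a b := he
      simp only [Sym2.lift_mk, Pi.smul_apply, dartVal, dif_pos h, dif_pos h.symm, smul_eq_mul,
        RingHom.id_apply]
      ring

theorem faceBoundary_mk (f : Face G rot → ZMod 2) {a b : V} (h : G.Adj a b) :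
    faceBoundary G rot f ⟨s(a, b), h⟩ = dartVal G rot f a b + dartVal G rot f b a := rfl

open scoped Classical in
theorem edgeIncidence_mulVec [Fintype G.edgeSet] (z : G.edgeSet → ZMod 2) (v : V) :
    (edgeIncidence G).mulVec z v =
      ∑ w, if h : G.Adj v w then z ⟨s(v, w), h⟩ else 0 := by
  have h1 : (edgeIncidence G).mulVec z v =
      ∑ e ∈ Finset.univ.filter (fun e : G.edgeSet => v ∈ (e : Sym2 V)), z e := by
    simp [Matrix.mulVec, dotProduct, edgeIncidence, Finset.sum_filter]
  have h2 : (∑ w, if h : G.Adj v w then z ⟨s(v, w), h⟩ else 0) =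
      ∑ w ∈ Finset.univ.filter (fun w => G.Adj v w),
        if h : G.Adj v w then z ⟨s(v, w), h⟩ else 0 := by
    rw [Finset.sum_filter]
    refine Finset.sum_congr rfl fun w _ => ?_
    split_ifs <;> rfl
  rw [h1, h2]
  symm
  refine Finset.sum_bij (fun w hw => ⟨s(v, w), (Finset.mem_filter.1 hw).2⟩) ?_ ?_ ?_ ?_
  · intro w hw
    simp
  · intro w hw w' hw' h
    have := congrArg Subtype.val h
    exact Sym2.congr_right.1 this
  · rintro ⟨e, he⟩ hv
    have hv : v ∈ e := (Finset.mem_filter.1 hv).2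
    obtain ⟨w, rfl⟩ := Sym2.mem_iff_exists.1 hv
    exact ⟨w, by simpa using he, rfl⟩
  · intro w hw
    rw [dif_pos (Finset.mem_filter.1 hw).2]

/-- The functions on the vertices that are constant on the connected components. -/
def locallyConstant : Submodule (ZMod 2) (V → ZMod 2) where
  carrier := {x | ∀ u v, G.Adj u v → x u = x v}
  add_mem' hx hy u v h := by simp [hx u v h, hy u v h]
  zero_mem' _ _ _ := rfl
  smul_mem' c x hx u v h := by simp [hx u v h]

theorem finrank_locallyConstant_le :
    Module.finrank (ZMod 2) (locallyConstant G) ≤ Nat.card G.ConnectedComponent := by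
  classical
  have : Fintype G.ConnectedComponent := Fintype.ofFinite _
  let T : (G.ConnectedComponent → ZMod 2) →ₗ[ZMod 2] (V → ZMod 2) :=
    LinearMap.funLeft _ _ G.connectedComponentMk
  have hle : locallyConstant G ≤ LinearMap.range T := by
    intro x hx
    have hreach : ∀ u v, G.Reachable u v → x u = x v := by
      rintro u v ⟨p⟩
      induction p with
      | nil => rfl
      | cons h _ ih => rw [hx _ _ h, ih]
    exact ⟨fun c => c.lift x (fun u v p _ => hreach u v ⟨p⟩), rfl⟩
  calc Module.finrank (ZMod 2) (locallyConstant G)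
      ≤ Module.finrank (ZMod 2) (LinearMap.range T) := Submodule.finrank_mono hle
    _ ≤ Module.finrank (ZMod 2) (G.ConnectedComponent → ZMod 2) := LinearMap.finrank_range_le T
    _ = Nat.card G.ConnectedComponent := by
      rw [Module.finrank_fintype_fun_eq_card, Nat.card_eq_fintype_card]

theorem ker_edgeIncidence_transpose_le :
    LinearMap.ker (edgeIncidence G).transpose.mulVecLin ≤ locallyConstant G := by
  classical
  intro x hx u v h
  have h1 := congrFun (LinearMap.mem_ker.1 hx) ⟨s(u, v), h⟩
  have h2 : ∑ w, (if w = u ∨ w = v then x w else 0) = x u + x v := by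
    rw [← Finset.sum_filter]
    have : Finset.univ.filter (fun w => w = u ∨ w = v) = {u, v} := by ext; simp
    rw [this, Finset.sum_pair h.ne]
  simp only [Matrix.mulVecLin_apply, Matrix.mulVec, dotProduct, Matrix.transpose_apply,
    edgeIncidence, Sym2.mem_iff, ite_mul, one_mul, zero_mul, Pi.zero_apply] at h1
  rw [h2] at h1
  exact CharTwo.add_eq_zero.1 h1

/-- The cycle space has dimension at most `E - V + C`. -/
theorem finrank_cycleSpace_le [Fintype G.edgeSet] :
    Module.finrank (ZMod 2) (LinearMap.ker (edgeIncidence G).mulVecLin) + Nat.card V ≤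
      G.edgeSet.ncard + Nat.card G.ConnectedComponent := by
  have h1 := (edgeIncidence G).mulVecLin.finrank_range_add_finrank_ker
  have h2 := (edgeIncidence G).transpose.mulVecLin.finrank_range_add_finrank_ker
  have h3 : (edgeIncidence G).transpose.rank = (edgeIncidence G).rank := Matrix.rank_transpose _
  rw [Matrix.rank, Matrix.rank] at h3
  have h4 := (Submodule.finrank_mono (ker_edgeIncidence_transpose_le G)).trans
    (finrank_locallyConstant_le G)
  rw [Module.finrank_fintype_fun_eq_card] at h1 h2
  rw [← Nat.card_eq_fintype_card] at h1 h2
  rw [Nat.card_coe_set_eq] at h1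
  omega

variable {G rot}

theorem range_faceBoundary_le [Fintype G.edgeSet]
    (hrot : ∀ v, ∃ l, IsNeighborList G v l ∧ rot v = l.formPerm) :
    LinearMap.range (faceBoundary G rot) ≤ LinearMap.ker (edgeIncidence G).mulVecLin := by
  classical
  rintro _ ⟨f, rfl⟩
  rw [LinearMap.mem_ker]
  ext v
  rw [Matrix.mulVecLin_apply, edgeIncidence_mulVec, Pi.zero_apply]
  have h1 : ∀ w, (if h : G.Adj v w then faceBoundary G rot f ⟨s(v, w), h⟩ else 0) =
      dartVal G rot f v w + dartVal G rot f v (rot v w) := by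
    intro w
    rw [dartVal_rot hrot]
    split_ifs with h
    · rw [faceBoundary_mk]
    · rw [dartVal, dartVal, dif_neg h, dif_neg (fun h' => h h'.symm), add_zero]
  rw [Finset.sum_congr rfl fun w _ => h1 w, Finset.sum_add_distrib,
    Equiv.sum_comp (rot v) (fun w => dartVal G rot f v w), CharTwo.add_self_eq_zero]

/-- A set of faces without boundary consists of all the faces of certain components. -/
theorem finrank_ker_faceBoundary_le
    (hrot : ∀ v, ∃ l, IsNeighborList G v l ∧ rot v = l.formPerm) :
    Module.finrank (ZMod 2) (LinearMap.ker (faceBoundary G rot)) ≤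
      Nat.card G.ConnectedComponent := by
  classical
  have hex : ∀ v, ∃ x : Face G rot, (∀ hv : ∀ w, ¬ G.Adj v w, x = Sum.inr ⟨v, hv⟩) ∧
      ((∃ w, G.Adj v w) → ∃ w, ∃ h : G.Adj v w, x = Sum.inl (Quot.mk _ ⟨(v, w), h⟩)) := by
    intro v
    by_cases hv : ∀ w, ¬ G.Adj v w
    · exact ⟨Sum.inr ⟨v, hv⟩, fun _ => rfl, fun ⟨w, hw⟩ => absurd hw (hv w)⟩
    · push Not at hv
      obtain ⟨w, hw⟩ := hv
      exact ⟨Sum.inl (Quot.mk _ ⟨(v, w), hw⟩), fun h => absurd hw (h w), fun _ => ⟨w, hw, rfl⟩⟩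
  choose face hiso hdart using hex
  have hval : ∀ f ∈ LinearMap.ker (faceBoundary G rot), ∀ a b, (h : G.Adj a b) →
      f (Sum.inl (Quot.mk _ ⟨(a, b), h⟩)) = f (face a) := by
    intro f hf a b h
    have hsymm : ∀ {c d}, G.Adj c d → dartVal G rot f c d = dartVal G rot f d c := by
      intro c d hcd
      have := congrFun (LinearMap.mem_ker.1 hf) ⟨s(c, d), hcd⟩
      rw [faceBoundary_mk] at this
      exact CharTwo.add_eq_zero.1 this
    obtain ⟨w, hw, hfw⟩ := hdart a ⟨b, h⟩
    have := eq_of_invariant_rot (hrot a) (φ := fun w => dartVal G rot f a w)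
      (fun w hw => by
        rw [dartVal_rot hrot, hsymm hw]) h hw
    rw [hfw]
    simpa [dartVal, h, hw] using this
  have hmem : ∀ f ∈ LinearMap.ker (faceBoundary G rot),
      LinearMap.funLeft (ZMod 2) (ZMod 2) face f ∈ locallyConstant G := by
    intro f hf u v h
    have := congrFun (LinearMap.mem_ker.1 hf) ⟨s(u, v), h⟩
    rw [faceBoundary_mk, dartVal, dartVal, dif_pos h, dif_pos h.symm, hval f hf, hval f hf] at this
    exact CharTwo.add_eq_zero.1 this
  refine le_trans (LinearMap.finrank_le_finrank_of_injective
    (f := (LinearMap.funLeft (ZMod 2) (ZMod 2) face).restrict hmem) ?_)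
    (finrank_locallyConstant_le G)
  rw [← LinearMap.ker_eq_bot, LinearMap.ker_eq_bot']
  rintro ⟨f, hf⟩ h0
  have h0 : ∀ v, f (face v) = 0 := fun v => congrFun (congrArg Subtype.val h0) v
  ext x
  rcases x with ⟨⟨a, b⟩, h⟩ | ⟨v, hv⟩
  · exact (hval f hf a b h).trans (h0 a)
  · have := h0 v
    rw [hiso v hv] at this
    exact this

/-- Euler's inequality: no rotation system has negative genus. -/
theorem euler_inequality (hrot : ∀ v, ∃ l, IsNeighborList G v l ∧ rot v = l.formPerm) :
    Nat.card V + numFaces G rot ≤ G.edgeSet.ncard + 2 * Nat.card G.ConnectedComponent := by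
  have : Fintype G.edgeSet := Fintype.ofFinite _
  have h1 := (faceBoundary G rot).finrank_range_add_finrank_ker
  have h2 := Submodule.finrank_mono (range_faceBoundary_le hrot)
  have h3 := finrank_ker_faceBoundary_le hrot
  have h4 := finrank_cycleSpace_le G
  rw [finrank_face] at h1
  omega

/-- A combinatorial Jordan curve theorem: in a plane embedding every even edge set `z` is the
boundary of a set of faces, here given as a function `f` on the darts that is constant along
each face and changes exactly across the edges of `z`. -/
theorem exists_faceColoring (H : PlaneGraph V) (z : Sym2 V → ZMod 2)
    (hz : ∀ v, ∑ w, (open scoped Classical in if H.graph.Adj v w then z s(v, w) else 0) = 0) :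
    ∃ f : V → V → ZMod 2, (∀ a b, f b (H.rot b a) = f a b) ∧
      ∀ a b, H.graph.Adj a b → f a b + f b a = z s(a, b) := by
  classical
  have : Fintype H.graph.edgeSet := Fintype.ofFinite _
  have h1 := (faceBoundary H.graph H.rot).finrank_range_add_finrank_ker
  have h3 := finrank_ker_faceBoundary_le H.circular
  have h4 := finrank_cycleSpace_le H.graph
  have h5 := H.euler
  rw [finrank_face] at h1
  have heq := Submodule.eq_of_le_of_finrank_le (range_faceBoundary_le H.circular) (by omega)
  have hmem : (fun e : H.graph.edgeSet => z e) ∈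
      LinearMap.ker (edgeIncidence H.graph).mulVecLin := by
    rw [LinearMap.mem_ker]
    ext v
    rw [Matrix.mulVecLin_apply, edgeIncidence_mulVec, Pi.zero_apply]
    refine Eq.trans ?_ (hz v)
    refine Finset.sum_congr rfl fun w _ => ?_
    split_ifs <;> rfl
  rw [← heq] at hmem
  obtain ⟨f, hf⟩ := hmem
  refine ⟨dartVal H.graph H.rot f, fun a b => dartVal_rot H.circular f a b, fun a b h => ?_⟩
  rw [← faceBoundary_mk H.graph H.rot f h, hf]

end Homology

/-! ### Orientations under flips -/

section Flips

variable {V : Type*} [DecidableEq V]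

/-- Away from the separating vertices a flip reverses the circular ordering at all vertices of
one part of the graph and keeps it at all others; the two parts are joined only through
separating vertices. -/
theorem exists_separator_of_isFlip {H H' : PlaneGraph V} (h : IsFlip H H') :
    ∃ (S : Finset V) (inside : V → Prop), S.card ≤ 2 ∧
      (∀ v w, H.graph.Adj v w → v ∉ S → w ∉ S → (inside v ↔ inside w)) ∧
      ∀ v ∉ S, (inside v → H'.rot v = (H.rot v)⁻¹) ∧ (¬ inside v → H'.rot v = H.rot v) := by
  obtain ⟨-, S, A, hS, hsep, hA | hA⟩ := h
  · have hall : ∀ v ∉ S, ∀ a b, H.graph.Adj v a → H.graph.Adj v b → s(v, a) ∈ A → s(v, b) ∈ A :=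
      fun v hv a b ha hb haA => by_contra fun hbA => hv (hsep v a b ha hb haA hbA)
    refine ⟨S, fun v => ∃ w, H.graph.Adj v w ∧ s(v, w) ∈ A, by omega, ?_, ?_⟩
    · intro v w hvw hv hw
      constructor
      · rintro ⟨a, ha, haA⟩
        exact ⟨v, hvw.symm, Sym2.eq_swap ▸ hall v hv a w ha hvw haA⟩
      · rintro ⟨a, ha, haA⟩
        exact ⟨w, hvw, Sym2.eq_swap ▸ hall w hw a v ha hvw.symm haA⟩
    · intro v hv
      obtain ⟨α, β, ⟨-, hl⟩, hα, hβ, hH, hH'⟩ := hA v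
      constructor
      · rintro ⟨w, hw, hwA⟩
        have : β = [] := List.eq_nil_iff_forall_not_mem.2 fun b hb =>
          hβ b hb (hall v hv w b hw ((hl b).1 (List.mem_append_right _ hb)) hwA)
        subst this
        rw [hH, hH', List.append_nil, List.append_nil, List.formPerm_reverse]
      · intro hout
        have : α = [] := List.eq_nil_iff_forall_not_mem.2 fun a ha =>
          hout ⟨a, (hl a).1 (List.mem_append_left _ ha), hα a ha⟩
        subst this
        rw [hH, hH', List.reverse_nil]
  · refine ⟨S, fun _ => False, by omega, by simp, fun v hv => ⟨False.elim, fun _ => ?_⟩⟩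
    obtain ⟨α, β, γ, ⟨-, hl⟩, hα, hβ, hH, hH'⟩ := hA v
    rcases α with _ | ⟨a, α⟩
    · rw [hH, hH', List.nil_append, List.append_nil]
    · have : β ++ γ = [] := List.eq_nil_iff_forall_not_mem.2 fun b hb =>
        hv (hsep v a b ((hl a).1 (by simp)) ((hl b).1 (by
          rw [List.append_assoc]; exact List.mem_append_right _ hb))
          (hα a (by simp)) (hβ b hb))
      obtain ⟨rfl, rfl⟩ := List.append_eq_nil_iff.1 this
      rw [hH, hH']
      simp

/-- The two circular orderings of three neighbours. -/
theorem rot_of_three_neighbors {G : SimpleGraph V} {v a c o : V} {π : Equiv.Perm V}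
    (hπ : ∃ l, IsNeighborList G v l ∧ π = l.formPerm) (hac : a ≠ c) (hao : a ≠ o) (hco : c ≠ o)
    (hv : ∀ w, G.Adj v w ↔ w = a ∨ w = c ∨ w = o) :
    (π a = c ∧ π c = o ∧ π o = a) ∨ (π a = o ∧ π o = c ∧ π c = a) := by
  obtain ⟨l, ⟨hnd, hl⟩, rfl⟩ := hπ
  have hperm : l.Perm [a, c, o] := by
    rw [List.perm_ext_iff_of_nodup hnd (by simp [hac, hao, hco])]
    intro w
    rw [hl, hv]
    simp
  have hlen := hperm.length_eq
  match l, hlen with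
  | [x, y, z], _ =>
    have h1 := (List.formPerm_apply_head x y [z] hnd)
    have h2 := List.formPerm_apply_lt_getElem _ hnd 1 (by simp)
    have h3 := List.formPerm_apply_getLast x [y, z]
    simp only [List.getElem_cons_succ, List.getElem_cons_zero, List.getLast_cons_cons,
      List.getLast_singleton] at h2 h3
    have ha : a ∈ [x, y, z] := hperm.mem_iff.2 (by simp)
    have hc : c ∈ [x, y, z] := hperm.mem_iff.2 (by simp)
    have ho : o ∈ [x, y, z] := hperm.mem_iff.2 (by simp)
    simp only [List.mem_cons, List.not_mem_nil, or_false] at ha hc ho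
    grind

/-- The number of changes in a sequence of truth values of length `m + 1`. -/
noncomputable def alternations (m : ℕ) (b : ℕ → Prop) : ℕ :=
  open scoped Classical in ((Finset.range m).filter fun i => ¬ (b i ↔ b (i + 1))).card

omit [DecidableEq V] in
theorem alternations_eq (m : ℕ) (b : ℕ → Prop) [DecidablePred fun i => ¬ (b i ↔ b (i + 1))] :
    alternations m b = ((Finset.range m).filter fun i => ¬ (b i ↔ b (i + 1))).card := by
  unfold alternations
  congr

variable {G : SimpleGraph V} {m : ℕ} {p a c o : ℕ → V}

/-- A flip changes the orientations along a path by a constant reversal on each of the pieces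
into which the at most two separating vertices cut the path. -/
theorem alternations_le_of_isFlip
    (hp : ∀ i < m, G.Adj (p i) (p (i + 1)))
    (hinj : ∀ i ≤ m, ∀ j ≤ m, p i = p j → i = j)
    (hac : ∀ i ≤ m, a i ≠ c i) (hao : ∀ i ≤ m, a i ≠ o i) (hco : ∀ i ≤ m, c i ≠ o i)
    (hnbr : ∀ i ≤ m, ∀ w, G.Adj (p i) w ↔ w = a i ∨ w = c i ∨ w = o i)
    {H H' : PlaneGraph V} (hH : H.graph = G) (h : IsFlip H H') :
    alternations m (fun i => H.rot (p i) (a i) = c i) ≤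
      alternations m (fun i => H'.rot (p i) (a i) = c i) + 4 := by
  classical
  subst hH
  obtain ⟨S, inside, hS, hin, hrot⟩ := exists_separator_of_isFlip h
  have hturn : ∀ i ≤ m, p i ∉ S →
      ((H'.rot (p i) (a i) = c i) ↔ (inside (p i) ↔ ¬ H.rot (p i) (a i) = c i)) := by
    intro i hi hiS
    have h3 := rot_of_three_neighbors (H.circular (p i)) (hac i hi) (hao i hi) (hco i hi)
      (hnbr i hi)
    have := hac i hi
    have := hao i hi
    have := hco i hi
    by_cases hi' : inside (p i)
    · rw [(hrot _ hiS).1 hi', Equiv.Perm.inv_eq_iff_eq]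
      rcases h3 with ⟨h1, h2, h3⟩ | ⟨h1, h2, h3⟩ <;> grind
    · rw [(hrot _ hiS).2 hi']
      tauto
  -- only a step of the path with an end in `S` can change; `T` lists the path vertices in `S`
  let T : Finset ℕ := (Finset.range (m + 1)).filter fun i => p i ∈ S
  have hT : T.card ≤ 2 := by
    refine le_trans (Finset.card_le_card_of_injOn p (fun i hi => ?_) (fun i hi j hj hij => ?_)) hS
    · exact (Finset.mem_filter.1 hi).2
    · exact hinj i (by simp [T] at hi; omega) j (by simp [T] at hj; omega) hij
  have hsub : ((Finset.range m).filter fun i => ¬ ((H.rot (p i) (a i) = c i) ↔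
        (H.rot (p (i + 1)) (a (i + 1)) = c (i + 1)))) ⊆
      ((Finset.range m).filter fun i => ¬ ((H'.rot (p i) (a i) = c i) ↔
        (H'.rot (p (i + 1)) (a (i + 1)) = c (i + 1)))) ∪ (T ∪ T.image (· - 1)) := by
    intro i hi
    rw [Finset.mem_filter, Finset.mem_range] at hi
    obtain ⟨him, hi⟩ := hi
    by_cases h1 : p i ∈ S
    · refine Finset.mem_union_right _ (Finset.mem_union_left _ ?_)
      simp [T, h1]; omega
    by_cases h2 : p (i + 1) ∈ S
    · refine Finset.mem_union_right _ (Finset.mem_union_right _ ?_)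
      exact Finset.mem_image.2 ⟨i + 1, by simp [T, h2]; omega, by simp⟩
    refine Finset.mem_union_left _ (Finset.mem_filter.2 ⟨Finset.mem_range.2 him, ?_⟩)
    rw [hturn i him.le h1, hturn (i + 1) him h2, ← hin _ _ (hp i him) h1 h2]
    tauto
  have h1 := Finset.card_le_card hsub
  have h2 := Finset.card_union_le ((Finset.range m).filter fun i =>
    ¬ ((H'.rot (p i) (a i) = c i) ↔ (H'.rot (p (i + 1)) (a (i + 1)) = c (i + 1))))
    (T ∪ T.image (· - 1))
  have h3 := Finset.card_union_le T (T.image (· - 1))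
  have h4 := Finset.card_image_le (s := T) (f := (· - 1))
  rw [alternations_eq, alternations_eq]
  omega

theorem FlipSeq.graph_eq {k : ℕ} {H K : PlaneGraph V} (h : FlipSeq k H K) :
    K.graph = H.graph := by
  induction h with
  | refl => rfl
  | step _ hf ih => rw [hf.1, ih]

theorem alternations_le_of_flipSeq
    (hp : ∀ i < m, G.Adj (p i) (p (i + 1)))
    (hinj : ∀ i ≤ m, ∀ j ≤ m, p i = p j → i = j)
    (hac : ∀ i ≤ m, a i ≠ c i) (hao : ∀ i ≤ m, a i ≠ o i) (hco : ∀ i ≤ m, c i ≠ o i)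
    (hnbr : ∀ i ≤ m, ∀ w, G.Adj (p i) w ↔ w = a i ∨ w = c i ∨ w = o i)
    {k : ℕ} {H K : PlaneGraph V} (hH : H.graph = G) (h : FlipSeq k H K) :
    alternations m (fun i => H.rot (p i) (a i) = c i) ≤
      alternations m (fun i => K.rot (p i) (a i) = c i) + 4 * k := by
  induction h with
  | refl => simp
  | step hs hf ih =>
    have h1 := ih hH
    have h2 := alternations_le_of_isFlip hp hinj hac hao hco hnbr (hs.graph_eq.trans hH) hf
    omega

end Flips

/-! ### Orientations along a cycle -/

/-- Let `P` be the vertex set of an induced cycle of a plane graph, and let `p 0, …, p m` be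
successive vertices of it, each with a single edge `p i → o i` leaving the cycle. If the `o i` are
connected off the cycle (stated as: a function that is constant along the edges off the cycle has
the same value on them), then these edges all leave to the same side: the orientation of
predecessor, successor and `o i` is the same at every `p i`. -/
theorem rot_iff_rot_of_cycle {V : Type*} [Fintype V] [DecidableEq V] (L : PlaneGraph V)
    (P : Set V) {m : ℕ} {p a c o : ℕ → V}
    (hcycle : ∀ v ∈ P, ∃ x y, x ≠ y ∧ ∀ w, (L.graph.Adj v w ∧ w ∈ P) ↔ w = x ∨ w = y)
    (hoff : ∀ φ : V → ZMod 2, (∀ v w, v ∉ P → w ∉ P → L.graph.Adj v w → φ v = φ w) →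
      ∀ i ≤ m, φ (o i) = φ (o 0))
    (hac : ∀ i ≤ m, a i ≠ c i) (hao : ∀ i ≤ m, a i ≠ o i) (hco : ∀ i ≤ m, c i ≠ o i)
    (hnbr : ∀ i ≤ m, ∀ w, L.graph.Adj (p i) w ↔ w = a i ∨ w = c i ∨ w = o i)
    (hpP : ∀ i ≤ m, p i ∈ P) (hcP : ∀ i ≤ m, c i ∈ P) (hoP : ∀ i ≤ m, o i ∉ P)
    (hc : ∀ i < m, c i = p (i + 1)) (ha : ∀ i < m, a (i + 1) = p i)
    {i : ℕ} (hi : i < m) :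
    L.rot (p i) (a i) = c i ↔ L.rot (p (i + 1)) (a (i + 1)) = c (i + 1) := by
  classical
  -- as the cycle is induced, its edges are those with both ends in `P`
  let z : Sym2 V → ZMod 2 := fun e => if ∀ v ∈ e, v ∈ P then 1 else 0
  have hz1 : ∀ v w, v ∈ P → w ∈ P → z s(v, w) = 1 := by
    intro v w hv hw
    simp [z, hv, hw]
  have hz0 : ∀ v w, v ∉ P → z s(v, w) = 0 := by
    intro v w hv
    simp [z, hv]
  obtain ⟨f, hf, hfz⟩ := exists_faceColoring L z (by
    intro v
    by_cases hv : v ∈ P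
    · obtain ⟨x, y, hxy, h⟩ := hcycle v hv
      have : ∀ w, (if L.graph.Adj v w then z s(v, w) else 0) =
          if w ∈ ({x, y} : Finset V) then (1 : ZMod 2) else 0 := by
        intro w
        have hw := h w
        by_cases h1 : L.graph.Adj v w <;> by_cases h2 : w ∈ P
        · rw [if_pos h1, hz1 v w hv h2, if_pos (by simpa using hw.1 ⟨h1, h2⟩)]
        · rw [if_pos h1, Sym2.eq_swap, hz0 w v h2, if_neg]
          intro h3
          exact h2 (hw.2 (by simpa using h3)).2
        all_goals
          rw [if_neg h1, if_neg]
          intro h3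
          exact h1 (hw.2 (by simpa using h3)).1
      rw [Finset.sum_congr rfl fun w _ => this w, Finset.sum_ite_mem, Finset.univ_inter,
        Finset.sum_pair hxy]
      rfl
    · refine Finset.sum_eq_zero fun w _ => ?_
      rw [hz0 v w hv, ite_self])
  have hout : ∀ v w, v ∉ P → L.graph.Adj v w → f v w = f w v := by
    intro v w hv hvw
    have := hfz v w hvw
    rw [hz0 v w hv] at this
    exact CharTwo.add_eq_zero.1 this
  -- off the cycle every vertex lies on one side, which does not change along edges
  have hconst : ∀ v, v ∉ P → ∀ x y, L.graph.Adj v x → L.graph.Adj v y → f v x = f v y := by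
    intro v hv x y hx hy
    exact eq_of_invariant_rot (L.circular v) (φ := f v)
      (fun w hw => by rw [hf, hout v w hv hw]) hx hy
  let side : V → ZMod 2 := fun v => if h : ∃ w, L.graph.Adj v w then f v h.choose else 0
  have hside : ∀ v w, v ∉ P → L.graph.Adj v w → side v = f v w := by
    intro v w hv hvw
    have h : ∃ w, L.graph.Adj v w := ⟨w, hvw⟩
    simp only [side, dif_pos h]
    exact hconst v hv _ _ h.choose_spec hvw
  have hsame : ∀ i ≤ m, side (o i) = side (o 0) := by
    refine hoff side fun v w hv hw hvw => ?_
    rw [hside v w hv hvw, hside w v hw hvw.symm, hout v w hv hvw]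
  -- the orientation at `p j` tells on which side the dart `p j → c j` has the vertices `o i`
  have key : ∀ j ≤ m, (L.rot (p j) (a j) = c j ↔ f (p j) (c j) = side (o 0) + 1) ∧
      (L.rot (p j) (a j) = c j ↔ f (a j) (p j) = side (o 0) + 1) := by
    intro j hj
    have hadj : L.graph.Adj (p j) (o j) := (hnbr j hj _).2 (by simp)
    have hadjc : L.graph.Adj (p j) (c j) := (hnbr j hj _).2 (by simp)
    have ho1 : f (o j) (p j) = side (o 0) := by
      rw [← hside _ _ (hoP j hj) hadj.symm]
      exact hsame j hj
    have ho2 : f (p j) (o j) = side (o 0) := by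
      rw [← ho1, hout _ _ (hoP j hj) hadj.symm]
    have hne : side (o 0) ≠ side (o 0) + 1 := by simp
    have hcc := hfz _ _ hadjc
    rw [hz1 _ _ (hpP j hj) (hcP j hj)] at hcc
    have e1 := hf (a j) (p j)
    have e2 := hf (c j) (p j)
    have e3 := hf (o j) (p j)
    have := hco j hj
    rcases rot_of_three_neighbors (L.circular (p j)) (hac j hj) (hao j hj) (hco j hj) (hnbr j hj)
      with ⟨h1, h2, h3⟩ | ⟨h1, h2, h3⟩
    · rw [h1] at e1
      rw [h2, ho2] at e2
      have : f (p j) (c j) = side (o 0) + 1 := by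
        rw [← e2] at hcc
        rw [← hcc, add_left_comm, CharTwo.add_self_eq_zero, add_zero]
      simp [h1, ← e1, this]
    · rw [h1, ho2] at e1
      rw [h2, ho1] at e3
      simp [h1, ← e1, e3, Ne.symm (hco j hj)]
  rw [(key i hi.le).1, (key (i + 1) hi).2, ha i hi, hc i hi]

/-! ### Criteria for planarity -/

section Planarity

theorem formPerm_map {V W : Type*} [DecidableEq V] [DecidableEq W] {f : V → W}
    (hf : Function.Injective f) : ∀ (l : List V) (a : V),
      (l.map f).formPerm (f a) = f (l.formPerm a)
  | [], a => rfl
  | [x], a => rfl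
  | x :: y :: l, a => by
    have ih := formPerm_map hf (y :: l) a
    rw [List.map_cons] at ih
    rw [List.map_cons, List.map_cons, List.formPerm_cons_cons, List.formPerm_cons_cons,
      Equiv.Perm.mul_apply, Equiv.Perm.mul_apply, ih, hf.swap_apply]

theorem IsPlanarGraph.of_iso {V W : Type*} [DecidableEq V] [DecidableEq W] {G : SimpleGraph V}
    {G' : SimpleGraph W} (φ : G ≃g G') (h : IsPlanarGraph G') : IsPlanarGraph G := by
  obtain ⟨H, rfl⟩ := h
  have hcirc : ∀ v, ∃ l, IsNeighborList G v l ∧ (φ.toEquiv.permCongr).symm (H.rot (φ v)) =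
      l.formPerm := by
    intro v
    obtain ⟨l, ⟨hnd, hl⟩, hrot⟩ := H.circular (φ v)
    refine ⟨l.map φ.symm, ⟨hnd.map φ.symm.injective, fun w => ?_⟩, ?_⟩
    · rw [← φ.map_adj_iff, ← hl, List.mem_map]
      constructor
      · rintro ⟨x, hx, rfl⟩
        simpa using hx
      · intro hw
        exact ⟨φ w, hw, by simp⟩
    · ext a
      have := formPerm_map φ.symm.injective l (φ a)
      rw [φ.symm_apply_apply] at this
      rw [this, hrot]
      rfl
  let e : G.Dart ≃ H.graph.Dart :=
    { toFun := fun d => ⟨(φ d.fst, φ d.snd), φ.map_adj_iff.2 d.adj⟩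
      invFun := fun d => ⟨(φ.symm d.fst, φ.symm d.snd), φ.symm.map_adj_iff.2 d.adj⟩
      left_inv := fun d => by ext <;> simp
      right_inv := fun d => by ext <;> simp }
  have h1 : Nat.card (Quot (FaceStep G fun v => (φ.toEquiv.permCongr).symm (H.rot (φ v)))) =
      Nat.card (Quot (FaceStep H.graph H.rot)) := by
    refine Nat.card_congr (Quot.congr e fun d d' => ?_)
    change (d'.fst = d.snd ∧ d'.snd = φ.symm (H.rot (φ d.snd) (φ d.fst))) ↔
      (φ d'.fst = φ d.snd ∧ φ d'.snd = H.rot (φ d.snd) (φ d.fst))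
    exact and_congr φ.injective.eq_iff.symm φ.toEquiv.eq_symm_apply
  have h2 : {v : V | ∀ w, ¬ G.Adj v w}.ncard = {v : W | ∀ w, ¬ H.graph.Adj v w}.ncard := by
    rw [← Set.ncard_image_of_injective _ φ.injective]
    congr 1
    ext v
    constructor
    · rintro ⟨v, hv, rfl⟩ w hw
      refine hv (φ.symm w) (φ.map_adj_iff.1 ?_)
      rwa [φ.apply_symm_apply]
    · intro hv
      refine ⟨φ.symm v, fun w hw => hv (φ w) ?_, φ.apply_symm_apply v⟩
      have := φ.map_adj_iff.2 hw
      rwa [φ.apply_symm_apply] at this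
  refine ⟨⟨G, fun v => (φ.toEquiv.permCongr).symm (H.rot (φ v)), hcirc, ?_⟩, rfl⟩
  rw [numFaces, h1, h2, Nat.card_congr φ.toEquiv, ← Nat.card_coe_set_eq G.edgeSet,
    Nat.card_congr φ.mapEdgeSet, Nat.card_congr φ.connectedComponentEquiv, Nat.card_coe_set_eq]
  exact H.euler

/-- Planarity from a face labelling. The lists `nbr v` are circular orderings, the labels of the
darts are constant along the faces, and they distinguish enough faces; by Euler's inequality
there cannot be more. -/
theorem isPlanarGraph_of_labels {V : Type*} [Fintype V] [DecidableEq V] {G : SimpleGraph V}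
    (nbr : V → List V) (hnbr : ∀ v, IsNeighborList G v (nbr v)) (label : V → V → ℕ)
    (hlabel : ∀ v (i : ℕ) (hi : i < (nbr v).length),
      label v ((nbr v)[(i + 1) % (nbr v).length]'(Nat.mod_lt _ (by omega))) =
        label (nbr v)[i] v)
    (F : Finset ℕ) (hF : ∀ k ∈ F, ∃ a b, G.Adj a b ∧ label a b = k)
    (hcount : G.edgeSet.ncard + 2 * Nat.card G.ConnectedComponent ≤
      Nat.card V + (F.card + {v : V | ∀ w, ¬ G.Adj v w}.ncard)) : IsPlanarGraph G := by
  classical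
  have hrot : ∀ v, ∃ l, IsNeighborList G v l ∧ (nbr v).formPerm = l.formPerm :=
    fun v => ⟨nbr v, hnbr v, rfl⟩
  refine ⟨⟨G, fun v => (nbr v).formPerm, hrot, le_antisymm (euler_inequality hrot)
    (hcount.trans ?_)⟩, rfl⟩
  have : Finite (Quot (FaceStep G fun v => (nbr v).formPerm)) := Quot.finite _
  let g : Quot (FaceStep G fun v => (nbr v).formPerm) → ℕ :=
    Quot.lift (fun d => label d.fst d.snd) (by
      rintro ⟨⟨a, v⟩, h⟩ ⟨⟨v', w⟩, h'⟩ ⟨h1, h2⟩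
      dsimp only at h1 h2 ⊢
      subst h1 h2
      obtain ⟨i, hi, rfl⟩ := List.getElem_of_mem (((hnbr v').2 a).2 h.symm)
      rw [List.formPerm_apply_getElem _ (hnbr v').1, hlabel v' i hi])
  have hsub : (F : Set ℕ) ⊆ Set.range g := by
    intro k hk
    obtain ⟨a, b, hab, rfl⟩ := hF k hk
    exact ⟨Quot.mk _ ⟨(a, b), hab⟩, rfl⟩
  have h1 : F.card ≤ Nat.card (Quot (FaceStep G fun v => (nbr v).formPerm)) := by
    rw [← Set.ncard_coe_finset]
    refine (Set.ncard_le_ncard hsub (Set.finite_range g)).trans ?_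
    rw [← Set.image_univ, ← Set.ncard_univ]
    exact Set.ncard_image_le
  unfold numFaces
  omega

end Planarity

/-! ### The heap graph and its faces -/

section HeapGraph

/-- The edges of the heap graph, directed from the larger endpoint to the smaller one: vertex `a`
of the binary heap `1, …, 2 ^ (d + 1) - 1` is joined to its parent `a / 2`, where the parent of the
root `1` is the apex `0`; the leaves are joined to the apex; and if `e` is set then the leaf `2 ^ d`
is joined to the root. -/
def HeapEdge (d : ℕ) (e : Bool) (a b : ℕ) : Prop :=
  (1 ≤ a ∧ a < 2 * 2 ^ d ∧ b = a / 2) ∨ (2 ^ d ≤ a ∧ a < 2 * 2 ^ d ∧ b = 0) ∨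
    (e = true ∧ a = 2 ^ d ∧ b = 1)

theorem HeapEdge.lt {d : ℕ} {e : Bool} {a b : ℕ} (hd : 2 ≤ d) (h : HeapEdge d e a b) :
    b < a ∧ a < 2 * 2 ^ d := by
  have : 2 ^ 2 ≤ 2 ^ d := Nat.pow_le_pow_right (by norm_num) hd
  unfold HeapEdge at h
  omega

/-- A complete binary tree of depth `d` whose root and leaves are joined to an apex; the other
vertices are isolated. With the flag `e` there is one more edge, from the root to the first
leaf. -/
def heapGraph (n d : ℕ) (e : Bool) : SimpleGraph (Fin n) where
  Adj a b := a ≠ b ∧ (HeapEdge d e a b ∨ HeapEdge d e b a)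
  symm := ⟨fun _ _ h => ⟨h.1.symm, h.2.symm⟩⟩
  loopless := ⟨fun _ h => h.1 rfl⟩

theorem heapGraph_adj {n d : ℕ} {e : Bool} (hd : 2 ≤ d) (a b : Fin n) :
    (heapGraph n d e).Adj a b ↔ HeapEdge d e a b ∨ HeapEdge d e b a := by
  refine ⟨fun h => h.2, fun h => ⟨?_, h⟩⟩
  rintro rfl
  rcases h with h | h <;> exact absurd (h.lt hd).1 (lt_irrefl _)

/-- The neighbours in the heap graph (`M = 2 ^ d`) in the circular ordering of the drawing with the
leaves in their natural order around the apex. -/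
def heapNeighbors (M : ℕ) (e : Bool) (x : ℕ) : List ℕ :=
  if x = 0 then 1 :: List.range' M M
  else if x = 1 then if e then [0, 3, 2, M] else [0, 3, 2]
  else if x < M then [x / 2, 2 * x + 1, 2 * x]
  else if x < 2 * M then if e ∧ x = M then [x / 2, 0, 1] else [x / 2, 0]
  else []

theorem nodup_heapNeighbors {M : ℕ} (hM : 4 ≤ M) (e : Bool) (x : ℕ) :
    (heapNeighbors M e x).Nodup := by
  unfold heapNeighbors
  split_ifs <;> simp [List.nodup_range'] <;> omega

theorem mem_heapNeighbors {d : ℕ} (hM : 4 ≤ 2 ^ d) (e : Bool) (x w : ℕ) :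
    w ∈ heapNeighbors (2 ^ d) e x ↔ HeapEdge d e x w ∨ HeapEdge d e w x := by
  unfold HeapEdge heapNeighbors
  generalize 2 ^ d = M at hM ⊢
  cases e <;> simp only [Bool.false_eq_true, false_and, true_and, if_true, if_false, or_false] <;>
    split_ifs <;> simp [List.mem_range'_1] <;> omega

/-- The label of the face along which the dart `a → b` of the heap graph runs. Without
the flag `e`, each face has one corner at the apex; it is labelled by the leaf that ends this
corner, and by `2 * M` if the corner lies between the last leaf and the root. With the flag, the
edge from the root to the first leaf divides the face `M`: the triangle that contains the apex gets
the label `0`, and the other part keeps `M`. Here `L x` is the first leaf below `x`, and `R x` is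
the successor of the last one. -/
def heapLabel (M : ℕ) (e : Bool) (L R : ℕ → ℕ) (a b : ℕ) : ℕ :=
  if e ∧ ((a = M ∧ b = 1) ∨ (a = 1 ∧ b = 0) ∨ (a = 0 ∧ b = M)) then 0
  else if e ∧ a = 1 ∧ b = M then M
  else if a = 0 ∧ b ≠ 1 then b
  else if b = 0 ∧ a ≠ 1 then a + 1
  else if b < a then L a
  else R b

theorem heapLabel_face {M : ℕ} (hM : 4 ≤ M) (e : Bool) {L R : ℕ → ℕ} (hL1 : L 1 = M)
    (hR1 : R 1 = 2 * M) (hL : ∀ x, 1 ≤ x → x < M → L (2 * x) = L x)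
    (hLR : ∀ x, 1 ≤ x → x < M → R (2 * x) = L (2 * x + 1))
    (hR : ∀ x, 1 ≤ x → x < M → R (2 * x + 1) = R x)
    (hLleaf : ∀ x, M ≤ x → x < 2 * M → L x = x) (hRleaf : ∀ x, M ≤ x → x < 2 * M → R x = x + 1)
    (x i : ℕ) (hi : i < (heapNeighbors M e x).length) :
    heapLabel M e L R x ((heapNeighbors M e x)[(i + 1) % (heapNeighbors M e x).length]'
        (Nat.mod_lt _ (by omega))) =
      heapLabel M e L R (heapNeighbors M e x)[i] x := by
  rcases Nat.eq_zero_or_pos x with rfl | hx0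
  · have hlen : (heapNeighbors M e 0).length = M + 1 := by simp [heapNeighbors]
    have hget : ∀ j (hj : j < (heapNeighbors M e 0).length),
        (heapNeighbors M e 0)[j] = if j = 0 then 1 else M + (j - 1) := by
      intro j hj
      rcases j with _ | j <;> simp [heapNeighbors]
    rw [hget, hget]
    simp only [hlen] at hi ⊢
    rcases Nat.lt_or_ge i M with h | h
    · rw [Nat.mod_eq_of_lt (by omega)]
      cases e <;> simp only [heapLabel] <;> grind
    · obtain rfl : i = M := by omega
      rw [Nat.mod_self]
      cases e <;> simp only [heapLabel] <;> grind
  by_cases hx1 : x = 1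
  · subst hx1
    have a1 := hL 1 le_rfl (by omega)
    have a2 := hLR 1 le_rfl (by omega)
    have a3 := hR 1 le_rfl (by omega)
    norm_num at a1 a2 a3
    cases e
    · have h : heapNeighbors M false 1 = [0, 3, 2] := by simp [heapNeighbors]
      simp only [h] at hi ⊢
      simp only [List.length_cons, List.length_nil] at hi ⊢
      interval_cases i <;> simp [heapLabel, *]
    · have h : heapNeighbors M true 1 = [0, 3, 2, M] := by simp [heapNeighbors]
      simp only [h] at hi ⊢
      simp only [List.length_cons, List.length_nil] at hi ⊢
      interval_cases i <;> simp [heapLabel] <;> grind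
  by_cases hxM : x < M
  · have h : heapNeighbors M e x = [x / 2, 2 * x + 1, 2 * x] := by
      simp [heapNeighbors, hxM, hx0.ne', hx1]
    have a1 := hL x hx0 hxM
    have a2 := hLR x hx0 hxM
    have a3 := hR x hx0 hxM
    simp only [h] at hi ⊢
    simp only [List.length_cons, List.length_nil] at hi ⊢
    interval_cases i <;> simp [heapLabel] <;> grind
  by_cases hx2 : x < 2 * M
  · have a1 := hLleaf x (by omega) hx2
    have a2 := hRleaf x (by omega) hx2
    by_cases he : e = true ∧ x = M
    · have h : heapNeighbors M e x = [x / 2, 0, 1] := by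
        rw [heapNeighbors, if_neg hx0.ne', if_neg hx1, if_neg hxM, if_pos hx2, if_pos he]
      simp only [h] at hi ⊢
      simp only [List.length_cons, List.length_nil] at hi ⊢
      interval_cases i <;> simp [heapLabel] <;> grind
    · have h : heapNeighbors M e x = [x / 2, 0] := by
        simp [heapNeighbors, hxM, hx0.ne', hx1, hx2, he]
      simp only [h] at hi ⊢
      simp only [List.length_cons, List.length_nil] at hi ⊢
      interval_cases i <;> simp [heapLabel] <;> grind
  · have h : heapNeighbors M e x = [] := by
      simp [heapNeighbors, hxM, hx0.ne', hx1, hx2]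
    simp [h] at hi

end HeapGraph

/-! ### Planarity of the heap graph -/

section HeapPlanarity

theorem card_connectedComponent_le {V : Type*} [Finite V] {G : SimpleGraph V} (r : V)
    (h : ∀ v, (∃ w, G.Adj v w) → G.Reachable v r) :
    Nat.card G.ConnectedComponent ≤ {v : V | ∀ w, ¬ G.Adj v w}.ncard + 1 := by
  rw [← Nat.card_coe_set_eq, ← Finite.card_option]
  refine Nat.card_le_card_of_surjective
    (fun o : Option {v : V | ∀ w, ¬ G.Adj v w} =>
      o.elim (G.connectedComponentMk r) fun v => G.connectedComponentMk v) ?_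
  intro c
  induction c using SimpleGraph.ConnectedComponent.ind with
  | h v =>
    by_cases hv : ∃ w, G.Adj v w
    · exact ⟨none, (SimpleGraph.ConnectedComponent.eq.2 (h v hv)).symm⟩
    · push Not at hv
      exact ⟨some ⟨v, hv⟩, rfl⟩

theorem four_le_two_pow {d : ℕ} (hd : 2 ≤ d) : 4 ≤ 2 ^ d :=
  (Nat.pow_le_pow_right (by norm_num) hd : 2 ^ 2 ≤ 2 ^ d)

variable {n d : ℕ} {e : Bool}

theorem heapGraph_reachable (hd : 2 ≤ d) (z : Fin n) (hz : z.val = 0) :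
    ∀ k (v : Fin n), v.val = k → k < 2 * 2 ^ d → (heapGraph n d e).Reachable v z := by
  intro k
  induction k using Nat.strong_induction_on with
  | _ k ih =>
    rintro v rfl hk
    rcases Nat.eq_zero_or_pos v.val with h0 | h0
    · rw [Fin.ext (h0.trans hz.symm)]
    · have hadj : (heapGraph n d e).Adj v ⟨v.val / 2, by omega⟩ :=
        (heapGraph_adj hd _ _).2 (Or.inl (Or.inl ⟨h0, hk, rfl⟩))
      exact hadj.reachable.trans (ih (v.val / 2) (by omega) _ rfl (by omega))

theorem ncard_edgeSet_heapGraph_le (hd : 2 ≤ d) (hn : 2 * 2 ^ d ≤ n) :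
    (heapGraph n d e).edgeSet.ncard ≤ 3 * 2 ^ d - 1 + e.toNat := by
  have h4 := four_le_two_pow hd
  have : NeZero n := ⟨by omega⟩
  let c : ℕ → Fin n := Fin.ofNat n
  have hc : ∀ v : Fin n, c v = v := fun v => Fin.ofNat_val_eq_self v
  let T : Finset (Sym2 (Fin n)) :=
    ((Finset.Ico 1 (2 * 2 ^ d)).image fun x => s(c x, c (x / 2))) ∪
      ((Finset.Ico (2 ^ d) (2 * 2 ^ d)).image fun x => s(c x, c 0)) ∪
      (if e then {s(c (2 ^ d), c 1)} else ∅)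
  have hsub : (heapGraph n d e).edgeSet ⊆ T := by
    have key : ∀ a b : Fin n, HeapEdge d e a b → s(a, b) ∈ T := by
      intro a b hab
      rw [← hc a, ← hc b]
      rcases hab with ⟨h1, h2, h3⟩ | ⟨h1, h2, h3⟩ | ⟨h1, h2, h3⟩
      · refine Finset.mem_union_left _ (Finset.mem_union_left _ (Finset.mem_image.2
          ⟨a, Finset.mem_Ico.2 ⟨h1, h2⟩, by rw [h3]⟩))
      · refine Finset.mem_union_left _ (Finset.mem_union_right _ (Finset.mem_image.2
          ⟨a, Finset.mem_Ico.2 ⟨h1, h2⟩, by rw [h3]⟩))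
      · refine Finset.mem_union_right _ ?_
        rw [if_pos h1, h2, h3]
        exact Finset.mem_singleton_self _
    intro s hs
    induction s with
    | _ a b =>
      rcases (heapGraph_adj hd a b).1 hs with h | h
      · exact key a b h
      · rw [Sym2.eq_swap]
        exact key b a h
  have h1 := Set.ncard_le_ncard hsub T.finite_toSet
  rw [Set.ncard_coe_finset] at h1
  -- parent edges, edges from the leaves to the apex, and the edge given by the flag
  have h2 : T.card ≤ (2 * 2 ^ d - 1) + (2 * 2 ^ d - 2 ^ d) + e.toNat := by
    refine (Finset.card_union_le _ _).trans (Nat.add_le_add ((Finset.card_union_le _ _).trans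
      (Nat.add_le_add (Finset.card_image_le.trans ?_) (Finset.card_image_le.trans ?_))) ?_)
    · rw [Nat.card_Ico]
    · rw [Nat.card_Ico]
    · cases e <;> simp
  omega

theorem ncard_isolated_heapGraph (hd : 2 ≤ d) (hn : 2 * 2 ^ d ≤ n) :
    {v : Fin n | ∀ w, ¬ (heapGraph n d e).Adj v w}.ncard + 2 * 2 ^ d ≤ n := by
  have h4 := four_le_two_pow hd
  have h1 := Set.ncard_add_ncard_compl {v : Fin n | ∀ w, ¬ (heapGraph n d e).Adj v w}
  rw [Nat.card_eq_fintype_card, Fintype.card_fin] at h1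
  have h2 : Set.range (Fin.castLE hn) ⊆ {v : Fin n | ∀ w, ¬ (heapGraph n d e).Adj v w}ᶜ := by
    rintro _ ⟨x, rfl⟩ hx
    have hx2 := x.isLt
    rcases Nat.eq_zero_or_pos x.val with h0 | h0
    · refine hx ⟨1, by omega⟩ ((heapGraph_adj hd _ _).2 (Or.inr (Or.inl ⟨le_rfl, ?_, ?_⟩)))
      · simp only; omega
      · simp [h0]
    · exact hx ⟨x / 2, by omega⟩ ((heapGraph_adj hd _ _).2 (Or.inl (Or.inl ⟨h0, hx2, rfl⟩)))
  have h3 := Set.ncard_le_ncard h2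
  rw [← Set.image_univ, Set.ncard_image_of_injective _ (Fin.castLE_injective hn),
    Set.ncard_univ, Nat.card_eq_fintype_card, Fintype.card_fin] at h3
  omega

theorem isPlanarGraph_heapGraph (hd : 2 ≤ d) (hn : 2 * 2 ^ d ≤ n) :
    IsPlanarGraph (heapGraph n d e) := by
  have h4 := four_le_two_pow hd
  have : NeZero n := ⟨by omega⟩
  let c : ℕ → Fin n := Fin.ofNat n
  have hcv : ∀ v : Fin n, c v = v := fun v => Fin.ofNat_val_eq_self v
  have hc : ∀ x, x < 2 * 2 ^ d → (c x).val = x := fun x hx => Nat.mod_eq_of_lt (by omega)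
  have hlt : ∀ x w, w ∈ heapNeighbors (2 ^ d) e x → w < 2 * 2 ^ d := by
    intro x w hw
    rcases (mem_heapNeighbors h4 e x w).1 hw with h | h
    · have := h.lt hd; omega
    · exact (h.lt hd).2
  -- the first leaf below `x`, and the successor of the last one
  let L : ℕ → ℕ := fun x => x * 2 ^ (d - Nat.log 2 x)
  let R : ℕ → ℕ := fun x => (x + 1) * 2 ^ (d - Nat.log 2 x)
  have hlog : ∀ x, 1 ≤ x → x < 2 ^ d → 2 ^ (d - Nat.log 2 x) = 2 * 2 ^ (d - (Nat.log 2 x + 1)) := by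
    intro x hx1 hx2
    have : Nat.log 2 x < d := (Nat.log_lt_iff_lt_pow (by norm_num) (by omega)).2 hx2
    rw [← pow_succ']
    congr 1
    omega
  have hlog1 : ∀ x, 1 ≤ x → Nat.log 2 (2 * x) = Nat.log 2 x + 1 := by
    intro x hx
    rw [mul_comm, Nat.log_mul_base (by norm_num) (by omega)]
  have hlog2 : ∀ x, 1 ≤ x → Nat.log 2 (2 * x + 1) = Nat.log 2 x + 1 := by
    intro x hx
    rw [Nat.log_of_one_lt_of_le (by norm_num) (by omega)]
    congr 2
    omega
  have hleaf : ∀ x, 2 ^ d ≤ x → x < 2 * 2 ^ d → Nat.log 2 x = d := by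
    intro x h1 h2
    exact Nat.log_eq_of_pow_le_of_lt_pow h1 (by rw [pow_succ']; exact h2)
  have hL1 : L 1 = 2 ^ d := by simp [L]
  have hR1 : R 1 = 2 * 2 ^ d := by simp [R]
  have hLleaf : ∀ x, 2 ^ d ≤ x → x < 2 * 2 ^ d → L x = x := by
    intro x h1 h2
    simp [L, hleaf x h1 h2]
  refine isPlanarGraph_of_labels (fun v => (heapNeighbors (2 ^ d) e v).map c) ?_
    (fun a b => heapLabel (2 ^ d) e L R a b) ?_
    (Finset.Icc (2 ^ d) (2 * 2 ^ d) ∪ if e then {0} else ∅) ?_ ?_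
  · intro v
    constructor
    · refine List.Nodup.map_on ?_ (nodup_heapNeighbors h4 e v)
      intro x hx y hy hxy
      have := congrArg Fin.val hxy
      rwa [hc x (hlt _ _ hx), hc y (hlt _ _ hy)] at this
    · intro w
      rw [heapGraph_adj hd, ← mem_heapNeighbors h4, List.mem_map]
      constructor
      · rintro ⟨x, hx, rfl⟩
        rwa [hc x (hlt _ _ hx)]
      · intro hw
        exact ⟨w, hw, hcv w⟩
  · intro v i hi
    simp only [List.length_map, List.getElem_map] at hi ⊢
    rw [hc _ (hlt _ _ (List.getElem_mem _)), hc _ (hlt _ _ (List.getElem_mem _))]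
    refine heapLabel_face h4 e hL1 hR1 ?_ ?_ ?_ hLleaf ?_ v i hi
    · intro x h1 h2
      simp only [L]
      rw [hlog1 x h1, hlog x h1 h2]
      ring
    · intro x h1 h2
      simp only [L, R]
      rw [hlog1 x h1, hlog2 x h1]
    · intro x h1 h2
      simp only [R]
      rw [hlog2 x h1, hlog x h1 h2]
      ring
    · intro x h1 h2
      simp [R, hleaf x h1 h2]
  · intro k hk
    have hex : ∀ a b, a < 2 * 2 ^ d → b < 2 * 2 ^ d → (HeapEdge d e a b ∨ HeapEdge d e b a) →
        heapLabel (2 ^ d) e L R a b = k →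
        ∃ a b : Fin n, (heapGraph n d e).Adj a b ∧ heapLabel (2 ^ d) e L R a b = k := by
      intro a b ha hb hab h
      refine ⟨c a, c b, ?_, ?_⟩
      · rw [heapGraph_adj hd, hc a ha, hc b hb]
        exact hab
      · rw [hc a ha, hc b hb]
        exact h
    rcases Finset.mem_union.1 hk with hk | hk
    · rw [Finset.mem_Icc] at hk
      by_cases h1 : k = 2 * 2 ^ d
      · refine hex 0 1 (by omega) (by omega) (Or.inr (Or.inl (by omega))) ?_
        rw [h1, ← hR1]
        simp [heapLabel]
        omega
      · by_cases h2 : e = true ∧ k = 2 ^ d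
        · refine hex 1 (2 ^ d) (by omega) (by omega) (Or.inr (Or.inr (Or.inr ⟨h2.1, rfl, rfl⟩))) ?_
          simp [heapLabel, h2]
          omega
        · refine hex 0 k (by omega) (by omega) (Or.inr (Or.inr (Or.inl ⟨hk.1, by omega, rfl⟩))) ?_
          unfold heapLabel
          rw [if_neg (by grind), if_neg (by omega), if_pos (by omega)]
    · cases e
      · simp at hk
      · obtain rfl : k = 0 := by simpa using hk
        refine hex 1 0 (by omega) (by omega) (Or.inl (Or.inl (by omega))) ?_
        simp [heapLabel]
  · have h1 := ncard_edgeSet_heapGraph_le (e := e) hd hn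
    have h2 := card_connectedComponent_le (G := heapGraph n d e) (c 0) (by
      rintro v ⟨w, hw⟩
      refine heapGraph_reachable hd (c 0) (hc 0 (by omega)) v v rfl ?_
      rcases (heapGraph_adj hd v w).1 hw with h | h
      · exact (h.lt hd).2
      · have := h.lt hd; omega)
    have h3 := ncard_isolated_heapGraph (e := e) hd hn
    have h5 : (Finset.Icc (2 ^ d) (2 * 2 ^ d) ∪ if e then {0} else ∅).card =
        2 ^ d + 1 + e.toNat := by
      cases e
      · simp; omega
      · rw [Finset.card_union_of_disjoint]
        · simp; omega
        · simp
    rw [Nat.card_fin, h5]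
    omega

end HeapPlanarity

/-! ### Automorphisms of the heap graph -/

section HeapAutomorphism

/-- The automorphism of the binary heap of depth `d` that swaps children as told by the bits of
`m < 2 ^ d`: the path to a vertex is added to the initial part of `m` of the same length. -/
def heapSwap (d m x : ℕ) : ℕ :=
  if x = 0 ∨ 2 * 2 ^ d ≤ x then x else x ^^^ (m / 2 ^ (d - Nat.log 2 x))

variable {d m : ℕ}

theorem heapSwap_div_pow (hm : m < 2 ^ d) {x k : ℕ} (hk : k ≤ d) (hx : x / 2 ^ k = 1) :
    (x ^^^ (m / 2 ^ (d - k))) / 2 ^ k = 1 := by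
  rw [Nat.xor_div_two_pow, hx, Nat.div_div_eq_div_mul, ← pow_add, Nat.sub_add_cancel hk,
    Nat.div_eq_of_lt hm]
  rfl

theorem div_pow_log {x : ℕ} (hx : x ≠ 0) : x / 2 ^ Nat.log 2 x = 1 := by
  have h1 := Nat.pow_log_le_self 2 hx
  have h2 := Nat.lt_pow_succ_log_self (b := 2) (by norm_num) x
  rw [pow_succ] at h2
  rw [Nat.div_eq_iff (by positivity)]
  omega

theorem log_eq_of_div_pow {x k : ℕ} (hx : x / 2 ^ k = 1) : Nat.log 2 x = k := by
  rw [Nat.div_eq_iff (by positivity)] at hx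
  refine Nat.log_eq_of_pow_le_of_lt_pow (by omega) ?_
  rw [pow_succ]
  have : 0 < 2 ^ k := by positivity
  omega

theorem log_le_of_lt {x : ℕ} (hx : x < 2 * 2 ^ d) : Nat.log 2 x ≤ d := by
  rw [← pow_succ'] at hx
  exact Nat.lt_succ_iff.1 (Nat.log_lt_of_lt_pow' (by omega) hx)

theorem log_heapSwap (hm : m < 2 ^ d) (x : ℕ) : Nat.log 2 (heapSwap d m x) = Nat.log 2 x := by
  unfold heapSwap
  split_ifs with h
  · rfl
  · push Not at h
    exact log_eq_of_div_pow (heapSwap_div_pow hm (log_le_of_lt h.2) (div_pow_log h.1))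

theorem heapSwap_eq_zero_iff (hm : m < 2 ^ d) (x : ℕ) : heapSwap d m x = 0 ↔ x = 0 := by
  unfold heapSwap
  split_ifs with h
  · rfl
  · push Not at h
    have := heapSwap_div_pow hm (log_le_of_lt h.2) (div_pow_log h.1)
    refine ⟨fun h0 => ?_, fun h0 => absurd h0 h.1⟩
    rw [h0] at this
    simp at this

theorem pow_le_heapSwap_iff (hm : m < 2 ^ d) (x k : ℕ) :
    2 ^ k ≤ heapSwap d m x ↔ 2 ^ k ≤ x := by
  by_cases hx : x = 0
  · rw [hx, (heapSwap_eq_zero_iff hm 0).2 rfl]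
  · rw [← Nat.le_log_iff_pow_le (by norm_num) hx, ← Nat.le_log_iff_pow_le (by norm_num)
      (mt (heapSwap_eq_zero_iff hm x).1 hx), log_heapSwap hm]

theorem heapSwap_lt_iff (hm : m < 2 ^ d) (x : ℕ) :
    heapSwap d m x < 2 * 2 ^ d ↔ x < 2 * 2 ^ d := by
  rw [← pow_succ', ← not_le, ← not_le, pow_le_heapSwap_iff hm]

theorem heapSwap_heapSwap (hm : m < 2 ^ d) (x : ℕ) : heapSwap d m (heapSwap d m x) = x := by
  by_cases h : x = 0 ∨ 2 * 2 ^ d ≤ x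
  · simp [heapSwap, h]
  · have h' : ¬ (heapSwap d m x = 0 ∨ 2 * 2 ^ d ≤ heapSwap d m x) := by
      rw [heapSwap_eq_zero_iff hm, ← not_lt, heapSwap_lt_iff hm, not_lt]
      exact h
    rw [heapSwap, if_neg h', log_heapSwap hm, heapSwap, if_neg h, Nat.xor_assoc, Nat.xor_self,
      Nat.xor_zero]

theorem heapSwap_div_two (hm : m < 2 ^ d) {x : ℕ} (hx : x < 2 * 2 ^ d) :
    heapSwap d m x / 2 = heapSwap d m (x / 2) := by
  rcases Nat.lt_or_ge x 2 with h2 | h2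
  · have h1 := (pow_le_heapSwap_iff hm x 1)
    rw [pow_one] at h1
    rw [Nat.div_eq_of_lt h2, (heapSwap_eq_zero_iff hm 0).2 rfl]
    omega
  · have hlog : Nat.log 2 x = Nat.log 2 (x / 2) + 1 :=
      Nat.log_of_one_lt_of_le (by norm_num) h2
    have hd := log_le_of_lt hx
    rw [heapSwap, heapSwap, if_neg (by omega), if_neg (by omega), Nat.xor_div_two, hlog,
      Nat.div_div_eq_div_mul, ← pow_succ]
    congr 3
    omega

theorem heapEdge_heapSwap (hm : m < 2 ^ d) {x y : ℕ} (h : HeapEdge d false x y) :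
    HeapEdge d false (heapSwap d m x) (heapSwap d m y) := by
  rcases h with ⟨h1, h2, h3⟩ | ⟨h1, h2, h3⟩ | ⟨h1, h2, h3⟩
  · have := heapSwap_eq_zero_iff hm x
    exact Or.inl ⟨by omega, (heapSwap_lt_iff hm x).2 h2, by rw [h3, heapSwap_div_two hm h2]⟩
  · exact Or.inr (Or.inl ⟨(pow_le_heapSwap_iff hm x d).2 h1, (heapSwap_lt_iff hm x).2 h2,
      (heapSwap_eq_zero_iff hm y).2 h3⟩)
  · cases h1

theorem heapEdge_heapSwap_iff (hm : m < 2 ^ d) {x y : ℕ} :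
    HeapEdge d false (heapSwap d m x) (heapSwap d m y) ↔ HeapEdge d false x y := by
  refine ⟨fun h => ?_, heapEdge_heapSwap hm⟩
  have := heapEdge_heapSwap hm h
  rwa [heapSwap_heapSwap hm, heapSwap_heapSwap hm] at this

variable {n : ℕ}

/-- Every leaf can be joined to the root: an automorphism of the heap graph takes it to the first
leaf. -/
theorem isPlanarGraph_heapGraph_sup_edge (hd : 2 ≤ d) (hn : 2 * 2 ^ d ≤ n) {r l : Fin n}
    (hr : r.val = 1) (hl1 : 2 ^ d ≤ l.val) (hl2 : l.val < 2 * 2 ^ d) :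
    IsPlanarGraph (heapGraph n d false ⊔ SimpleGraph.edge r l) := by
  have h4 := four_le_two_pow hd
  have hm : l.val ^^^ 2 ^ d < 2 ^ d := by
    have h1 : (l.val ^^^ 2 ^ d) / 2 ^ d = 0 := by
      have : l.val / 2 ^ d = 1 := by
        rw [Nat.div_eq_iff (by positivity)]
        omega
      rw [Nat.xor_div_two_pow, this, Nat.div_self (by positivity)]
      rfl
    rcases Nat.div_eq_zero_iff.1 h1 with h | h
    · omega
    · exact h
  have hlog : Nat.log 2 l.val = d := by
    refine log_eq_of_div_pow ?_
    rw [Nat.div_eq_iff (by positivity)]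
    omega
  have hswap : heapSwap d (l.val ^^^ 2 ^ d) l.val = 2 ^ d := by
    rw [heapSwap, if_neg (by omega), hlog, Nat.sub_self, pow_zero, Nat.div_one, ← Nat.xor_assoc,
      Nat.xor_self, Nat.zero_xor]
  have hswap1 : heapSwap d (l.val ^^^ 2 ^ d) 1 = 1 := by
    rw [heapSwap, if_neg (by omega), Nat.log_one_right, Nat.sub_zero, Nat.div_eq_of_lt hm]
    rfl
  generalize l.val ^^^ 2 ^ d = m at hm hswap hswap1
  have hlt : ∀ v : Fin n, heapSwap d m v < n := by
    intro v
    have h1 := heapSwap_lt_iff hm v.val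
    by_cases h : v.val < 2 * 2 ^ d
    · omega
    · rw [heapSwap, if_pos (by omega)]
      exact v.isLt
  have hinv : Function.Involutive fun v : Fin n => (⟨heapSwap d m v, hlt v⟩ : Fin n) := by
    intro v
    exact Fin.ext (heapSwap_heapSwap hm v.val)
  have heq : ∀ x y, heapSwap d m x = y ↔ x = heapSwap d m y := by
    intro x y
    constructor
    · rintro rfl; rw [heapSwap_heapSwap hm]
    · rintro rfl; rw [heapSwap_heapSwap hm]
  have htrue : ∀ x y, HeapEdge d true x y ↔ HeapEdge d false x y ∨ (x = 2 ^ d ∧ y = 1) := by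
    intro x y
    simp [HeapEdge, or_assoc]
  refine IsPlanarGraph.of_iso (G' := heapGraph n d true) ⟨hinv.toPerm, fun {a b} => ?_⟩
    (isPlanarGraph_heapGraph hd hn)
  rw [heapGraph_adj hd, SimpleGraph.sup_adj, heapGraph_adj hd, SimpleGraph.edge_adj]
  simp only [Function.Involutive.coe_toPerm]
  rw [htrue, htrue, heapEdge_heapSwap_iff hm, heapEdge_heapSwap_iff hm, heq, heq, heq, heq, hswap1,
    ← hswap, heapSwap_heapSwap hm, ← hr, ← Fin.ext_iff, ← Fin.ext_iff, ← Fin.ext_iff,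
    ← Fin.ext_iff]
  have : r ≠ l := by
    rintro rfl
    omega
  grind

end HeapAutomorphism

/-! ### Root-leaf paths -/

section HeapPath

variable {q : ℕ → ℕ}

theorem heapPath_bounds (hq0 : q 0 = 1) (hq : ∀ i, q (i + 1) = 2 * q i ∨ q (i + 1) = 2 * q i + 1)
    (i : ℕ) : 2 ^ i ≤ q i ∧ q i < 2 * 2 ^ i := by
  induction i with
  | zero => simp [hq0]
  | succ i ih =>
    have := hq i
    rw [pow_succ]
    omega

theorem heapPath_strictMono (hq0 : q 0 = 1)
    (hq : ∀ i, q (i + 1) = 2 * q i ∨ q (i + 1) = 2 * q i + 1) : StrictMono q := by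
  refine strictMono_nat_of_lt_succ fun i => ?_
  have := hq i
  have := (heapPath_bounds hq0 hq i).1
  have : 0 < 2 ^ i := by positivity
  omega

theorem heapEdge_heapPath_iff (hq0 : q 0 = 1)
    (hq : ∀ i, q (i + 1) = 2 * q i ∨ q (i + 1) = 2 * q i + 1) {d i j : ℕ} (hi : i ≤ d) :
    HeapEdge d false (q i) (q j) ↔ j + 1 = i := by
  have hpos : ∀ i, 0 < q i := fun i =>
    lt_of_lt_of_le (by positivity) (heapPath_bounds hq0 hq i).1
  constructor
  · rintro (⟨-, -, h⟩ | ⟨-, -, h⟩ | ⟨h, -⟩)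
    · rcases i with _ | i
      · have := hpos j
        omega
      · have := hq i
        exact congrArg (· + 1) ((heapPath_strictMono hq0 hq).injective (by omega))
    · exact absurd h (hpos j).ne'
    · cases h
  · rintro rfl
    have h1 := (heapPath_bounds hq0 hq (j + 1)).2
    have h2 : 2 ^ (j + 1) ≤ 2 ^ d := Nat.pow_le_pow_right (by norm_num) hi
    have h3 := hpos (j + 1)
    have := hq j
    exact Or.inl ⟨h3, by omega, by omega⟩

/-- A downward path in the infinite binary heap whose every turn is chosen in view of the last two
vertices. -/
theorem exists_heapPath (f : ℕ → ℕ → ℕ → Prop) :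
    ∃ q : ℕ → ℕ, q 0 = 1 ∧ (∀ i, q (i + 1) = 2 * q i ∨ q (i + 1) = 2 * q i + 1) ∧
      ∀ i, q (i + 2) = 2 * q (i + 1) ↔ f i (q i) (q (i + 1)) := by
  classical
  let s : ℕ → ℕ × ℕ := fun i => Nat.rec (1, 2)
    (fun i x => (x.2, if f i x.1 x.2 then 2 * x.2 else 2 * x.2 + 1)) i
  have h1 : ∀ i, (s (i + 1)).1 = (s i).2 := fun i => rfl
  have h2 : ∀ i, (s (i + 1)).2 = if f i (s i).1 (s i).2 then 2 * (s i).2 else 2 * (s i).2 + 1 :=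
    fun i => rfl
  refine ⟨fun i => (s i).1, rfl, fun i => ?_, fun i => ?_⟩
  · rcases i with _ | i
    · exact Or.inl rfl
    · simp only [h1]
      rw [h2]
      split_ifs <;> simp
  · simp only [h1]
    rw [h2]
    split_ifs with h <;> simp [h]

variable {n d : ℕ} [NeZero n]

/-- If the leaf `q d` is joined to the root, then in a plane embedding the path from the root to
`q d` turns to the same side at all its inner vertices: the edges that leave the cycle formed by
this path and the new edge all lead to the apex. -/
theorem rot_heapPath_of_edge (hd : 2 ≤ d) (hn : 2 * 2 ^ d ≤ n) (hq0 : q 0 = 1)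
    (hq : ∀ i, q (i + 1) = 2 * q i ∨ q (i + 1) = 2 * q i + 1) {o : ℕ → ℕ}
    (ho : ∀ i, o i / 2 = q (i + 1)) (hoq : ∀ i, o i ≠ q (i + 2))
    (hnbr : ∀ i ≤ d - 2, ∀ w : Fin n, (heapGraph n d false).Adj (Fin.ofNat n (q (i + 1))) w ↔
      w = Fin.ofNat n (q i) ∨ w = Fin.ofNat n (q (i + 2)) ∨ w = Fin.ofNat n (o i))
    (L : PlaneGraph (Fin n)) (hL : L.graph = heapGraph n d false ⊔
      SimpleGraph.edge (Fin.ofNat n 1) (Fin.ofNat n (q d))) {i : ℕ} (hi : i < d - 2) :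
    L.rot (Fin.ofNat n (q (i + 1))) (Fin.ofNat n (q i)) = Fin.ofNat n (q (i + 2)) ↔
      L.rot (Fin.ofNat n (q (i + 2))) (Fin.ofNat n (q (i + 1))) = Fin.ofNat n (q (i + 3)) := by
  have h4 := four_le_two_pow hd
  have hc : ∀ x, x < 2 * 2 ^ d → (Fin.ofNat n x).val = x := fun x hx => Nat.mod_eq_of_lt (by omega)
  have hmono := heapPath_strictMono hq0 hq
  have hpos : ∀ i, 0 < q i := fun i =>
    lt_of_lt_of_le (by positivity) (heapPath_bounds hq0 hq i).1
  have hlt : ∀ i, i ≤ d → q i < 2 * 2 ^ d := fun i hi =>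
    lt_of_le_of_lt (hmono.monotone hi) (heapPath_bounds hq0 hq d).2
  have hcq : ∀ i, i ≤ d → (Fin.ofNat n (q i)).val = q i := fun i hi => hc _ (hlt i hi)
  have hinj : ∀ i j, i ≤ d → j ≤ d → Fin.ofNat n (q i) = Fin.ofNat n (q j) → i = j := by
    intro i j hi hj h
    have := congrArg Fin.val h
    rw [hcq i hi, hcq j hj] at this
    exact hmono.injective this
  have holt : ∀ i, i ≤ d - 2 → o i < 2 * 2 ^ d := by
    intro i hi
    have h1 := ho i
    have h2 := hq (i + 1)
    have h3 := (heapPath_bounds hq0 hq (i + 1)).2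
    have h5 : 2 ^ (i + 1) * 2 ≤ 2 ^ d := by
      rw [← pow_succ]
      exact Nat.pow_le_pow_right (by norm_num) (by omega)
    omega
  have hco : ∀ i, i ≤ d - 2 → (Fin.ofNat n (o i)).val = o i := fun i hi => hc _ (holt i hi)
  let P : Set (Fin n) := {v | ∃ j ≤ d, v = Fin.ofNat n (q j)}
  have hmemP : ∀ j, j ≤ d → Fin.ofNat n (q j) ∈ P := fun j hj => ⟨j, hj, rfl⟩
  have hP : ∀ x, x < 2 * 2 ^ d → (Fin.ofNat n x ∈ P ↔ ∃ j ≤ d, x = q j) := by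
    intro x hx
    constructor
    · rintro ⟨j, hj, h⟩
      refine ⟨j, hj, ?_⟩
      rw [← hc x hx, h, hcq j hj]
    · rintro ⟨j, hj, rfl⟩
      exact hmemP j hj
  have hadj : ∀ j j', j ≤ d → j' ≤ d → (L.graph.Adj (Fin.ofNat n (q j)) (Fin.ofNat n (q j')) ↔
      j' + 1 = j ∨ j + 1 = j' ∨ (j = 0 ∧ j' = d) ∨ (j = d ∧ j' = 0)) := by
    intro j j' hj hj'
    rw [hL, SimpleGraph.sup_adj, heapGraph_adj hd, SimpleGraph.edge_adj, hcq j hj, hcq j' hj',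
      heapEdge_heapPath_iff hq0 hq hj, heapEdge_heapPath_iff hq0 hq hj', ← hq0]
    have e1 := fun i j hi hj => (⟨hinj i j hi hj, fun h => h ▸ rfl⟩ :
      Fin.ofNat n (q i) = Fin.ofNat n (q j) ↔ i = j)
    rw [ne_eq, e1 _ _ hj hj', e1 _ _ hj (Nat.zero_le _), e1 _ _ hj le_rfl,
      e1 _ _ hj' (Nat.zero_le _), e1 _ _ hj' le_rfl]
    omega
  have hadj2 : ∀ v w : Fin n, (heapGraph n d false).Adj v w → L.graph.Adj v w := by
    intro v w h
    rw [hL]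
    exact Or.inl h
  have hle := rot_iff_rot_of_cycle L P (m := d - 2) (p := fun i => Fin.ofNat n (q (i + 1)))
    (a := fun i => Fin.ofNat n (q i)) (c := fun i => Fin.ofNat n (q (i + 2)))
    (o := fun i => Fin.ofNat n (o i))
  refine hle ?_ ?_ ?_ ?_ ?_ ?_ ?_ ?_ ?_ ?_ ?_ hi
  · rintro _ ⟨j, hj, rfl⟩
    have hmain : ∀ a b, a ≤ d → b ≤ d → a ≠ b →
        (∀ j' ≤ d, (j' + 1 = j ∨ j + 1 = j' ∨ (j = 0 ∧ j' = d) ∨ (j = d ∧ j' = 0)) ↔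
          j' = a ∨ j' = b) →
        ∃ x y, x ≠ y ∧ ∀ w, (L.graph.Adj (Fin.ofNat n (q j)) w ∧ w ∈ P) ↔ w = x ∨ w = y := by
      intro a b ha hb hab h
      refine ⟨Fin.ofNat n (q a), Fin.ofNat n (q b), fun h => hab (hinj a b ha hb h), fun w => ?_⟩
      constructor
      · rintro ⟨hw, j', hj', rfl⟩
        rcases (h j' hj').1 ((hadj j j' hj hj').1 hw) with rfl | rfl <;> simp
      · rintro (rfl | rfl)
        · exact ⟨(hadj j a hj ha).2 ((h a ha).2 (Or.inl rfl)), hmemP a ha⟩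
        · exact ⟨(hadj j b hj hb).2 ((h b hb).2 (Or.inr rfl)), hmemP b hb⟩
    rcases Nat.eq_zero_or_pos j with h0 | h0
    · exact hmain 1 d (by omega) le_rfl (by omega) (by omega)
    · rcases hj.lt_or_eq with h1 | h1
      · exact hmain (j - 1) (j + 1) (by omega) (by omega) (by omega) (by omega)
      · exact hmain (d - 1) 0 (by omega) (by omega) (by omega) (by omega)
  · intro φ hφ
    -- off the path, every vertex is joined to the apex through its first descendants: none of
    -- them is on the path, as a path vertex has all its ancestors on the path
    have hzero : ∀ k x, x + k = 2 * 2 ^ d → 1 ≤ k → Fin.ofNat n x ∉ P →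
        φ (Fin.ofNat n x) = φ (Fin.ofNat n 0) := by
      intro k
      induction k using Nat.strong_induction_on with
      | _ k ih =>
        intro x hxk hk hxP
        have hzP : Fin.ofNat n 0 ∉ P := by
          rw [hP 0 (by omega)]
          rintro ⟨j, -, h⟩
          exact (hpos j).ne h
        rcases Nat.eq_zero_or_pos x with rfl | hx0
        · rfl
        rcases Nat.lt_or_ge x (2 ^ d) with hx | hx
        · have h2P : Fin.ofNat n (2 * x) ∉ P := by
            rw [hP _ (by omega)]
            rintro ⟨j, hj, h⟩
            rcases j with _ | j
            · omega
            · refine hxP ((hP x (by omega)).2 ⟨j, by omega, ?_⟩)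
              have := hq j
              omega
          rw [← ih (k - x) (by omega) (2 * x) (by omega) (by omega) h2P]
          refine hφ _ _ hxP h2P (hadj2 _ _ ((heapGraph_adj hd _ _).2 (Or.inr ?_)))
          rw [hc x (by omega), hc (2 * x) (by omega)]
          exact Or.inl ⟨by omega, by omega, by omega⟩
        · refine hφ _ _ hxP hzP (hadj2 _ _ ((heapGraph_adj hd _ _).2 (Or.inl ?_)))
          rw [hc x (by omega), hc 0 (by omega)]
          exact Or.inr (Or.inl ⟨hx, by omega, rfl⟩)
    have hoP : ∀ i ≤ d - 2, φ (Fin.ofNat n (o i)) = φ (Fin.ofNat n 0) := by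
      intro i hi
      have := holt i hi
      refine hzero (2 * 2 ^ d - o i) (o i) (by omega) (by omega) ?_
      rw [hP _ this]
      rintro ⟨j, hj, h⟩
      have h1 := ho i
      rcases j with _ | j
      · have := hpos (i + 1)
        omega
      · have := hq j
        have h2 : j = i + 1 := hmono.injective (by omega)
        subst h2
        exact hoq i h
    intro i hi
    rw [hoP i hi, hoP 0 (Nat.zero_le _)]
  · intro i hi h
    have := hinj _ _ (by omega) (by omega) h
    omega
  · intro i hi h
    have := congrArg Fin.val h
    rw [hcq i (by omega), hco i hi] at this
    have h1 := ho i
    have h2 := hmono (show i < i + 1 by omega)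
    omega
  · intro i hi h
    have := congrArg Fin.val h
    rw [hcq (i + 2) (by omega), hco i hi] at this
    exact hoq i this.symm
  · intro i hi w
    rw [← hnbr i hi w, hL, SimpleGraph.sup_adj, SimpleGraph.edge_adj]
    constructor
    · rintro (h | ⟨⟨h, -⟩ | ⟨h, -⟩, -⟩)
      · exact h
      · rw [← hq0] at h
        have := hinj _ _ (by omega) (by omega) h
        omega
      · have := hinj _ _ (by omega) le_rfl h
        omega
    · exact Or.inl
  · exact fun i hi => hmemP _ (by omega)
  · exact fun i hi => hmemP _ (by omega)
  · intro i hi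
    rw [hP _ (holt i hi)]
    rintro ⟨j, hj, h⟩
    have h1 := ho i
    rcases j with _ | j
    · have := hpos (i + 1)
      omega
    · have := hq j
      have h2 : j = i + 1 := hmono.injective (by omega)
      subst h2
      exact hoq i h
  · exact fun i _ => rfl
  · exact fun i _ => rfl

end HeapPath

/-! ### The lower bound for a single insertion -/

section LowerBound

/-- In every plane embedding of the heap graph there is a leaf such that joining it to the root
requires many flips: the path to it is chosen to turn alternately to either side of the
embedding. -/
theorem exists_leaf_of_planeGraph {n d : ℕ} [NeZero n] (hd : 2 ≤ d) (hn : 2 * 2 ^ d ≤ n)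
    (H : PlaneGraph (Fin n)) (hH : H.graph = heapGraph n d false) :
    ∃ l : Fin n, 2 ^ d ≤ l.val ∧ l.val < 2 * 2 ^ d ∧ ∀ k K L, FlipSeq k H K →
      IsEdgeInsertion (Fin.ofNat n 1) l K L → d - 2 ≤ 4 * k := by
  obtain ⟨q, hq0, hq, hqf⟩ := exists_heapPath fun i a b =>
    H.rot (Fin.ofNat n b) (Fin.ofNat n a) = Fin.ofNat n (2 * b) ↔ Even i
  have h4 := four_le_two_pow hd
  have hc : ∀ x, x < 2 * 2 ^ d → (Fin.ofNat n x).val = x := fun x hx => Nat.mod_eq_of_lt (by omega)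
  have hcinj : ∀ x y, x < 2 * 2 ^ d → y < 2 * 2 ^ d → Fin.ofNat n x = Fin.ofNat n y → x = y := by
    intro x y hx hy h
    rw [← hc x hx, h, hc y hy]
  have hmono := heapPath_strictMono hq0 hq
  have hlt : ∀ i, i ≤ d → q i < 2 * 2 ^ d := fun i hi =>
    lt_of_le_of_lt (hmono.monotone hi) (heapPath_bounds hq0 hq d).2
  have hinner : ∀ i ≤ d - 2, 2 ≤ q (i + 1) ∧ q (i + 1) < 2 ^ d := by
    intro i hi
    have h1 := heapPath_bounds hq0 hq (i + 1)
    have h2 : 2 ^ (i + 1) * 2 ≤ 2 ^ d := by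
      rw [← pow_succ]
      exact Nat.pow_le_pow_right (by norm_num) (by omega)
    have h3 : 2 ^ 1 ≤ 2 ^ (i + 1) := Nat.pow_le_pow_right (by norm_num) (by omega)
    omega
  -- the child that is not on the path
  let o : ℕ → ℕ := fun i => if q (i + 2) = 2 * q (i + 1) then 2 * q (i + 1) + 1 else 2 * q (i + 1)
  have ho : ∀ i, o i / 2 = q (i + 1) := by
    intro i
    simp only [o]
    split_ifs <;> omega
  have hoq : ∀ i, o i ≠ q (i + 2) := by
    intro i
    have := hq (i + 1)
    simp only [o]
    split_ifs <;> omega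
  have hnbr : ∀ i ≤ d - 2, ∀ w : Fin n,
      (heapGraph n d false).Adj (Fin.ofNat n (q (i + 1))) w ↔
        w = Fin.ofNat n (q i) ∨ w = Fin.ofNat n (q (i + 2)) ∨ w = Fin.ofNat n (o i) := by
    intro i hi w
    have h1 := hinner i hi
    have h2 := hq i
    have h3 : q (i + 2) = 2 * q (i + 1) ∨ q (i + 2) = 2 * q (i + 1) + 1 := hq (i + 1)
    have h5 := ho i
    have h6 := hoq i
    have h7 := hlt (i + 2) (by omega)
    rw [heapGraph_adj hd, hc _ (by omega), Fin.ext_iff, Fin.ext_iff, Fin.ext_iff,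
      hc (q i) (by omega), hc (q (i + 2)) h7, hc (o i) (by omega)]
    unfold HeapEdge
    simp only [Bool.false_eq_true, false_and, or_false]
    have := w.isLt
    omega
  have holt : ∀ i ≤ d - 2, o i < 2 * 2 ^ d := by
    intro i hi
    have := ho i
    have := (hinner i hi).2
    omega
  have hac : ∀ i ≤ d - 2, Fin.ofNat n (q i) ≠ Fin.ofNat n (q (i + 2)) := by
    intro i hi h
    have := hmono.injective (hcinj _ _ (hlt _ (by omega)) (hlt _ (by omega)) h)
    omega
  have hao : ∀ i ≤ d - 2, Fin.ofNat n (q i) ≠ Fin.ofNat n (o i) := by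
    intro i hi h
    have h1 := hcinj _ _ (hlt _ (by omega)) (holt i hi) h
    have h2 := ho i
    have h3 := hq i
    have h5 := hinner i hi
    omega
  have hco : ∀ i ≤ d - 2, Fin.ofNat n (q (i + 2)) ≠ Fin.ofNat n (o i) := by
    intro i hi h
    exact hoq i (hcinj _ _ (hlt _ (by omega)) (holt i hi) h).symm
  have hturn : ∀ i ≤ d - 2, (H.rot (Fin.ofNat n (q (i + 1))) (Fin.ofNat n (q i)) =
      Fin.ofNat n (q (i + 2)) ↔ Even i) := by
    intro i hi
    have h1 := hqf i
    by_cases h2 : q (i + 2) = 2 * q (i + 1)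
    · rw [h2]
      exact h1.1 h2
    · have h3 : o i = 2 * q (i + 1) := if_neg h2
      have h5 := hco i hi
      rw [← h3] at h1
      have h6 := mt h1.2 (hoq i).symm
      have := rot_of_three_neighbors (H.circular (Fin.ofNat n (q (i + 1)))) (hac i hi) (hao i hi)
        (hco i hi) (by rw [hH]; exact hnbr i hi)
      grind
  refine ⟨Fin.ofNat n (q d), ?_, ?_, fun k K L hK hL => ?_⟩
  · rw [hc _ (hlt d le_rfl)]
    exact (heapPath_bounds hq0 hq d).1
  · rw [hc _ (hlt d le_rfl)]
    exact hlt d le_rfl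
  have hinj : ∀ i ≤ d - 2, ∀ j ≤ d - 2, Fin.ofNat n (q (i + 1)) = Fin.ofNat n (q (j + 1)) →
      i = j := by
    intro i hi j hj h
    have := hmono.injective (hcinj _ _ (hlt _ (by omega)) (hlt _ (by omega)) h)
    omega
  have hp : ∀ i < d - 2, (heapGraph n d false).Adj (Fin.ofNat n (q (i + 1)))
      (Fin.ofNat n (q (i + 1 + 1))) := fun i hi => (hnbr i hi.le _).2 (by simp)
  have h1 := alternations_le_of_flipSeq (p := fun i => Fin.ofNat n (q (i + 1)))
    (a := fun i => Fin.ofNat n (q i)) (c := fun i => Fin.ofNat n (q (i + 2)))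
    (o := fun i => Fin.ofNat n (o i)) hp hinj hac hao hco hnbr hH hK
  obtain ⟨-, -, hLgraph, -, -, hLrot⟩ := hL
  have h2 : alternations (d - 2) (fun i => H.rot (Fin.ofNat n (q (i + 1))) (Fin.ofNat n (q i)) =
      Fin.ofNat n (q (i + 2))) = d - 2 := by
    rw [alternations_eq, Finset.filter_true_of_mem, Finset.card_range]
    intro i hi
    rw [Finset.mem_range] at hi
    rw [hturn i hi.le, hturn (i + 1) hi, Nat.even_add_one]
    tauto
  have hKL : ∀ i ≤ d - 2, L.rot (Fin.ofNat n (q (i + 1))) = K.rot (Fin.ofNat n (q (i + 1))) := by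
    intro i hi
    refine hLrot _ (fun h => ?_) (fun h => ?_)
    · have := hcinj _ _ (hlt _ (by omega)) (by omega) h
      have := hinner i hi
      omega
    · have := hmono.injective (hcinj _ _ (hlt _ (by omega)) (hlt _ le_rfl) h)
      omega
  have h3 : alternations (d - 2) (fun i => K.rot (Fin.ofNat n (q (i + 1))) (Fin.ofNat n (q i)) =
      Fin.ofNat n (q (i + 2))) = 0 := by
    rw [alternations_eq, Finset.card_eq_zero, Finset.filter_eq_empty_iff]
    intro i hi
    rw [Finset.mem_range] at hi
    rw [not_not, ← hKL i hi.le, ← hKL (i + 1) hi]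
    exact rot_heapPath_of_edge hd hn hq0 hq ho hoq hnbr L
      (by rw [hLgraph, hK.graph_eq, hH]) hi
  omega

end LowerBound

/-! ### The adversary -/

section Adversaries

variable {V : Type*} [DecidableEq V]

/-- The adversary that alternately inserts an edge chosen in view of the current embedding and
deletes it again. -/
noncomputable def insertDeleteAdversary [Nonempty V] (pick : PlaneGraph V → V × V) : Adversary V :=
  fun h =>
    ((if Even h.length then h.dropLast else h).getLast?.map pick).getD (Classical.arbitrary _)

theorem nextEdge_insertDeleteAdversary [Nonempty V] (pick : PlaneGraph V → V × V)
    (E : ℕ → PlaneGraph V) (j : ℕ) :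
    nextEdge (insertDeleteAdversary pick) E j = pick (E (if Even j then j else j - 1)) := by
  unfold nextEdge insertDeleteAdversary
  by_cases hj : Even j
  · simp [hj, Nat.even_add_one, List.range_succ]
  · obtain ⟨i, rfl⟩ : ∃ i, j = i + 1 := ⟨j - 1, by grind⟩
    simp [hj, Nat.even_add_one, List.range_succ]

variable [Nonempty V] {G : SimpleGraph V} {pick : PlaneGraph V → V × V}

theorem IsRun.graph_eq {m : ℕ} {E : ℕ → PlaneGraph V}
    (hE : IsRun G (insertDeleteAdversary pick) m E)
    (hpick : ∀ H : PlaneGraph V, H.graph = G → (pick H).1 ≠ (pick H).2 ∧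
      ¬ G.Adj (pick H).1 (pick H).2) :
    ∀ j ≤ m, (Even j → (E j).graph = G) ∧ (¬ Even j → (E (j - 1)).graph = G ∧
      (E j).graph = G ⊔ SimpleGraph.edge (pick (E (j - 1))).1 (pick (E (j - 1))).2) := by
  intro j
  induction j with
  | zero => exact fun _ => ⟨fun _ => hE.1, fun h => absurd Even.zero h⟩
  | succ j ih =>
    intro hj
    have h1 := hE.2 j hj
    rw [nextEdge_insertDeleteAdversary] at h1
    obtain ⟨ih1, ih2⟩ := ih (by omega)
    rw [Nat.even_add_one, not_not, Nat.add_sub_cancel]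
    constructor
    · intro hodd
      obtain ⟨h2, h3⟩ := ih2 hodd
      rw [h1.2 hodd, if_neg hodd, h3]
      ext a b
      have h4 := (hpick _ h2).2
      rw [SimpleGraph.deleteEdges_adj, SimpleGraph.sup_adj, SimpleGraph.edge_adj,
        Set.mem_singleton_iff, Sym2.eq_iff]
      constructor
      · rintro ⟨h | ⟨h, -⟩, h'⟩
        · exact h
        · grind
      · intro h
        refine ⟨Or.inl h, ?_⟩
        rintro (⟨rfl, rfl⟩ | ⟨rfl, rfl⟩)
        · exact h4 h
        · exact h4 h.symm
    · intro heven
      refine ⟨ih1 heven, ?_⟩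
      rw [h1.1 heven, if_pos heven, ih1 heven]

theorem IsRun.isLegalUpdate {m : ℕ} {E : ℕ → PlaneGraph V}
    (hE : IsRun G (insertDeleteAdversary pick) m E)
    (hpick : ∀ H : PlaneGraph V, H.graph = G → (pick H).1 ≠ (pick H).2 ∧
      ¬ G.Adj (pick H).1 (pick H).2 ∧
      IsPlanarGraph (G ⊔ SimpleGraph.edge (pick H).1 (pick H).2)) :
    IsLegalUpdate (insertDeleteAdversary pick) E m := by
  obtain ⟨h1, h2⟩ := hE.graph_eq (fun H hH => ⟨(hpick H hH).1, (hpick H hH).2.1⟩) m le_rfl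
  unfold IsLegalUpdate
  rw [nextEdge_insertDeleteAdversary]
  constructor
  · intro heven
    rw [if_pos heven, h1 heven]
    exact hpick _ (h1 heven)
  · intro hodd
    obtain ⟨h3, h4⟩ := h2 hodd
    rw [if_neg hodd, h4, SimpleGraph.sup_adj, SimpleGraph.edge_adj]
    exact Or.inr ⟨Or.inl ⟨rfl, rfl⟩, (hpick _ h3).1⟩

/-- As every other update is an insertion, a lower bound for insertions holds, up to a factor of
`2`, for the average over all updates. -/
theorem mul_le_sum_of_even {f : ℕ → ℕ} {c : ℝ} (hc : 0 ≤ c) :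
    ∀ m : ℕ, (∀ j < m, Even j → 2 * c ≤ f j) → c * m ≤ ∑ j ∈ Finset.range m, (f j : ℝ)
  | 0, _ => by simp
  | 1, h => by
    have := h 0 (by norm_num) Even.zero
    simp
    linarith
  | m + 2, h => by
    have ih := mul_le_sum_of_even hc m fun j hj => h j (by omega)
    rw [Finset.sum_range_succ, Finset.sum_range_succ]
    push_cast
    have h0 : (0 : ℝ) ≤ f m := Nat.cast_nonneg _
    have h1 : (0 : ℝ) ≤ f (m + 1) := Nat.cast_nonneg _
    rcases Nat.even_or_odd m with hm | hm
    · have := h m (by omega) hm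
      linarith
    · have := h (m + 1) (by omega) hm.add_one
      linarith

end Adversaries

/-! ### Graphs with at most one edge, and the conclusion -/

theorem isPlanarGraph_bot {V : Type*} [Fintype V] [DecidableEq V] :
    IsPlanarGraph (⊥ : SimpleGraph V) := by
  refine isPlanarGraph_of_labels (fun _ => []) (fun v => ⟨List.nodup_nil, by simp⟩) (fun _ _ => 0)
    (fun v i hi => absurd hi (by simp)) ∅ (by simp) ?_
  have h1 : Nat.card (⊥ : SimpleGraph V).ConnectedComponent ≤ Nat.card V :=
    Nat.card_le_card_of_surjective _ Quot.mk_surjective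
  have h2 : {v : V | ∀ w, ¬ (⊥ : SimpleGraph V).Adj v w} = Set.univ := by
    ext; simp
  rw [SimpleGraph.edgeSet_bot, Set.ncard_empty, h2, Set.ncard_univ, Finset.card_empty]
  omega

theorem isPlanarGraph_edge {V : Type*} [Fintype V] [DecidableEq V] {a b : V} (hab : a ≠ b) :
    IsPlanarGraph (SimpleGraph.edge a b) := by
  have hadj : ∀ v w, (SimpleGraph.edge a b).Adj v w ↔ (v = a ∧ w = b) ∨ (v = b ∧ w = a) := by
    intro v w
    rw [SimpleGraph.edge_adj]
    grind
  refine isPlanarGraph_of_labels (fun v => if v = a then [b] else if v = b then [a] else [])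
    (fun v => ?_) (fun _ _ => 0) (fun v i hi => rfl) {0} ?_ ?_
  · constructor
    · split_ifs <;> simp
    · intro w
      rw [hadj]
      split_ifs with h1 h2 <;> simp <;> grind
  · intro k hk
    exact ⟨a, b, (hadj a b).2 (Or.inl ⟨rfl, rfl⟩), (Finset.mem_singleton.1 hk).symm⟩
  · have h1 := card_connectedComponent_le (G := SimpleGraph.edge a b) a (by
      rintro v ⟨w, hw⟩
      rcases (hadj v w).1 hw with ⟨rfl, rfl⟩ | ⟨rfl, rfl⟩
      · exact SimpleGraph.Reachable.refl _
      · exact hw.reachable)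
    have h2 : (SimpleGraph.edge a b).edgeSet.ncard ≤ 1 := by
      rw [SimpleGraph.edgeSet_edge_of_ne hab, Set.ncard_singleton]
    have h3 := Set.ncard_add_ncard_compl {v : V | ∀ w, ¬ (SimpleGraph.edge a b).Adj v w}
    have h4 : ({a, b} : Set V) ⊆ {v : V | ∀ w, ¬ (SimpleGraph.edge a b).Adj v w}ᶜ := by
      rintro v (rfl | rfl) hv
      · exact hv b ((hadj _ _).2 (Or.inl ⟨rfl, rfl⟩))
      · exact hv a ((hadj _ _).2 (Or.inr ⟨rfl, rfl⟩))
    have h5 := Set.ncard_le_ncard h4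
    rw [Set.ncard_pair hab] at h5
    simp only [Finset.card_singleton]
    omega

theorem mainTheorem4 :
    ∃ c : ℝ, 0 < c ∧ ∃ N : ℕ, ∀ n : ℕ, 2 ≤ n →
      ∃ (G : SimpleGraph (Fin n)) (adv : Adversary (Fin n)),
        IsPlanarGraph G ∧
        ∀ (m : ℕ) (E : ℕ → PlaneGraph (Fin n)), IsRun G adv m E →
          -- the run can be continued by a further update
          IsLegalUpdate adv E m ∧
          (N ≤ n →
            -- every insertion requires at least `c * log n` flips
            (∀ j < m, Even j → ∀ k : ℕ, UpdateWithFlips adv E j k → c * Real.log n ≤ k) ∧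
            -- the average number of flips per update is at least `c * log n`
            (∀ f : ℕ → ℕ, (∀ j < m, UpdateWithFlips adv E j (f j)) →
              c * Real.log n * m ≤ ∑ j ∈ Finset.range m, (f j : ℝ))) := by
  classical
  -- an insertion takes at least `(d - 2) / 4` flips, where `log n ≤ d + 2`; for `d ≥ 6` this is at
  -- least `(d + 2) / 8`, which leaves a factor of `2` for the deletions
  refine ⟨1 / 16, by norm_num, 128, fun n hn2 => ?_⟩
  have : NeZero n := ⟨by omega⟩
  rcases Nat.lt_or_ge n 128 with hn | hn
  · -- here only the legality of the updates is claimed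
    have h01 : (⟨0, by omega⟩ : Fin n) ≠ ⟨1, by omega⟩ := by simp
    refine ⟨⊥, insertDeleteAdversary fun _ => (⟨0, by omega⟩, ⟨1, by omega⟩), isPlanarGraph_bot,
      fun m E hE => ⟨hE.isLegalUpdate fun H _ => ⟨h01, by simp, ?_⟩, fun h => by omega⟩⟩
    rw [bot_sup_eq]
    exact isPlanarGraph_edge h01
  -- the deepest binary heap that fits into `n` vertices
  obtain ⟨d, hd⟩ : ∃ d, Nat.log 2 n = d + 1 := by
    have : 7 ≤ Nat.log 2 n := Nat.le_log_of_pow_le (by norm_num) (by omega)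
    exact ⟨Nat.log 2 n - 1, by omega⟩
  have hd6 : 6 ≤ d := by
    have : 7 ≤ Nat.log 2 n := Nat.le_log_of_pow_le (by norm_num) (by omega)
    omega
  have hdn : 2 * 2 ^ d ≤ n := by
    rw [← pow_succ', ← hd]
    exact Nat.pow_log_le_self 2 (by omega)
  have hnd : n < 2 ^ (d + 2) := by
    have := Nat.lt_pow_succ_log_self (b := 2) (by norm_num) n
    rwa [hd] at this
  have hlog : Real.log n ≤ d + 2 := by
    have h1 : Real.log n ≤ Real.log ((2 : ℝ) ^ (d + 2)) :=
      Real.log_le_log (by positivity) (by exact_mod_cast hnd.le)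
    rw [Real.log_pow] at h1
    have h2 := Real.log_two_lt_d9
    have h3 : (0 : ℝ) ≤ ((d + 2 : ℕ) : ℝ) := Nat.cast_nonneg _
    push_cast at h1 h3
    nlinarith
  have hlog0 : 0 ≤ Real.log n := Real.log_natCast_nonneg n
  have hd2 : 2 ≤ d := by omega
  have h4 := four_le_two_pow hd2
  have hleaf : ∀ H : PlaneGraph (Fin n), ∃ l : Fin n, H.graph = heapGraph n d false →
      2 ^ d ≤ l.val ∧ l.val < 2 * 2 ^ d ∧ ∀ k K L, FlipSeq k H K →
        IsEdgeInsertion (Fin.ofNat n 1) l K L → d - 2 ≤ 4 * k := by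
    intro H
    by_cases hH : H.graph = heapGraph n d false
    · obtain ⟨l, hl⟩ := exists_leaf_of_planeGraph hd2 hdn H hH
      exact ⟨l, fun _ => hl⟩
    · exact ⟨0, fun h => absurd h hH⟩
  choose leaf hleaf using hleaf
  have h1val : (Fin.ofNat n 1).val = 1 := Nat.mod_eq_of_lt (by omega)
  have hpick : ∀ H : PlaneGraph (Fin n), H.graph = heapGraph n d false →
      Fin.ofNat n 1 ≠ leaf H ∧ ¬ (heapGraph n d false).Adj (Fin.ofNat n 1) (leaf H) ∧
        IsPlanarGraph (heapGraph n d false ⊔ SimpleGraph.edge (Fin.ofNat n 1) (leaf H)) := by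
    intro H hH
    obtain ⟨h1, h2, -⟩ := hleaf H hH
    refine ⟨fun h => ?_, fun h => ?_, isPlanarGraph_heapGraph_sup_edge hd2 hdn h1val h1 h2⟩
    · rw [← h] at h1
      omega
    · rw [heapGraph_adj hd2, h1val] at h
      simp only [HeapEdge, Bool.false_eq_true, false_and, or_false] at h
      omega
  refine ⟨heapGraph n d false, insertDeleteAdversary fun H => (Fin.ofNat n 1, leaf H),
    isPlanarGraph_heapGraph hd2 hdn, fun m E hE => ⟨hE.isLegalUpdate hpick, fun _ => ?_⟩⟩
  have hins : ∀ j < m, Even j → ∀ k : ℕ,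
      UpdateWithFlips (insertDeleteAdversary fun H => (Fin.ofNat n 1, leaf H)) E j k →
        2 * (1 / 16 * Real.log n) ≤ k := by
    intro j hj heven k hk
    have hG := (hE.graph_eq (fun H hH => ⟨(hpick H hH).1, (hpick H hH).2.1⟩) j hj.le).1 heven
    have h1 := hk.1 heven
    rw [nextEdge_insertDeleteAdversary, if_pos heven] at h1
    -- only the flips before the insertion are counted
    obtain ⟨k₁, k₂, K, L, rfl, hK, hL, -⟩ := h1
    have h2 : d - 2 ≤ 4 * k₁ := (hleaf _ hG).2.2 k₁ K L hK hL
    have h3 : (d : ℝ) ≤ 4 * k₁ + 2 := by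
      have : d ≤ 4 * k₁ + 2 := by omega
      exact_mod_cast this
    have h5 : (6 : ℝ) ≤ d := by exact_mod_cast hd6
    have h6 : (0 : ℝ) ≤ k₂ := Nat.cast_nonneg _
    push_cast
    linarith
  refine ⟨fun j hj heven k hk => ?_, fun f hf => ?_⟩
  · have := hins j hj heven k hk
    linarith
  · exact mul_le_sum_of_even (by linarith) m fun j hj heven => hins j hj heven _ (hf j hj)
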